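/- Let $x=(x_t)_{t\in\mathbb Z}$, $x_t=(x_{t1},\dots,x_{tp})^T$, be a strictly stationary and ergodic $\mathbb R^p$-valued process with finite fourth moments (the independent component model $x_t=\Omega z_t$ with $\Omega=I_p$, so $x=z$). Let $\mathcal T_1,\mathcal T_2$ be finite sets of nonnegative integer lags and $b\in[0,1]$. Put $$\mu_{\tau j}=E(x_{tj}x_{t+\tau,j}),\qquad \nu_{\tau j}=E(x_{tj}^2x_{t+\tau,j}^2)-1,$$ $$D_{jl}=2b\sum_{\tau\in\mathcal T_1}(\mu_{\tau j}-\mu_{\tau l})^2+4(1-b)\sum_{\tau\in\mathcal T_2}\bigl(\nu_{\tau j}^2+\nu_{\tau l}^2-2(\nu_{\tau j}+\nu_{\tau l})\mu_{\tau j}\mu_{\tau l}\bigr),$$ $$c_{jl}=2b\sum_{\tau\in\mathcal T_1}\mu_{\tau j}(\mu_{\tau l}-\mu_{\tau j})+4(1-b)\sum_{\tau\in\mathcal T_2}\bigl(\nu_{\tau l}-\nu_{\tau j}(\nu_{\tau j}+1)+2\nu_{\tau l}\mu_{\tau j}\mu_{\tau l}\bigr).$$ Assume - (A1) $E(x_t)=0$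 and $\mathrm{cov}(x_t)=I_p$; - (A2) the $p$ component series $(x_{t1})_t,\dots,(x_{tp})_t$ are independent; - (A3) $D_{jl}\neq0$ for all $j\neq l$. For $n\ge1$ let $\bar x=\frac1n\sum_{t=1}^n x_t$, let $\hat S=\frac1n\sum_{t=1}^n(x_t-\bar x)(x_t-\bar x)^T$ be the sample covariance matrix, and for $\gamma\in\mathbb R^p$ let $$\hat T(\gamma)=b\,\hat T^s(\gamma)+(1-b)\,\hat T^v(\gamma),$$ $$\hat T^s(\gamma)=\sum_{\tau\in\mathcal T_1}\Bigl(\tfrac1n\sum_{t=1}^{n-\tau}(\gamma^Tx_t)(\gamma^Tx_{t+\tau})\Bigr)\Bigl(\tfrac1n\sum_{t=1}^{n-\tau}\bigl[(\gamma^Tx_{t+\tau})x_t+(\gamma^Tx_t)x_{t+\tau}\bigr]\Bigr),$$ $$\hat T^v(\gamma)=2\sum_{\tau\in\mathcal T_2}\Bigl(\tfrac1n\sum_{t=1}^{n-\tau}\bigl[(\gamma^Tx_t)^2(\gamma^Tx_{t+\tau})^2-1\bigr]\Bigr)\Bigl(\tfrac1n\sum_{t=1}^{n-\tau}\bigl[(\gamma^Tx_t)(\gamma^Tx_{t+\tau})^2x_t+(\gamma^Tx_t)^2(\gamma^Tx_{t+\tau})x_{t+\tau}\bigr]\Bigr),$$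 and $T_j=\hat T(e_j)$, where $e_j$ is the $j$-th unit vector. The gSOBI estimating equations for a $p\times p$ matrix $\Gamma=(\gamma_1,\dots,\gamma_p)^T$ are $$\gamma_j^T\hat T(\gamma_l)=\gamma_l^T\hat T(\gamma_j),\qquad \gamma_j^T\hat S\gamma_l=\delta_{jl},\qquad j,l=1,\dots,p.$$ For $r>0$, a sequence of random matrices $\hat\Gamma=\hat\Gamma_n$ is called a gSOBI estimator ($r$-localized at $I_p$) if, with probability tending to one, $\hat\Gamma$ solves these equations and all entries of $\hat\Gamma-I_p$ are at most $r$ in absolute value. (The equations are invariant under permutations and sign changes of the rows, so a selection of this kind is needed.) Then there is $r>0$ such that a gSOBI estimator localized at $I_p$ exists as a measurable function of $x_1,\dots,x_n$, and every such estimator $\hat\Gamma=(\hat\gamma_{jl})$ satisfies $\hat\Gamma\to_P I_p$. If moreover $\sqrt n(\hat S-I_p)=O_p(1)$ and $\sqrt n\,e_l^TT_j=O_p(1)$ for all $j\ne l$, then $$\sqrt n(\hat\gamma_{jj}-1)=-\tfrac12\sqrt n(\hat S_{jj}-1)+o_p(1)\quad\text{for all }j,$$ $$\sqrt n\,\hat\gamma_{jl}=\bigl(e_l^T\sqrt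 n\,T_j-e_j^T\sqrt n\,T_l+c_{jl}\sqrt n\,\hat S_{jl}\bigr)D_{jl}^{-1}+o_p(1)\quad\text{for all }j\neq l.$$ -/

import Mathlib

open MeasureTheory ProbabilityTheory Filter Topology
open scoped ENNReal

noncomputable section

namespace GSOBI

/-! ### Population quantities -/

/-- Linear autocorrelation `μ_{τ j} = E (z_{t j} z_{t+τ, j})` of a stationary series (at `t = 0`). -/
def linCorr {Ω : Type*} [MeasurableSpace Ω] {p : ℕ} (P : Measure Ω)
    (x : ℤ → Ω → Fin p → ℝ) (τ : ℕ) (j : Fin p) : ℝ :=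
  ∫ ω, x 0 ω j * x (τ : ℤ) ω j ∂P

/-- Quadratic autocorrelation `ν_{τ j} = E (x_{t j}² x_{t+τ, j}²) - 1` (at `t = 0`). -/
def quadCorr {Ω : Type*} [MeasurableSpace Ω] {p : ℕ} (P : Measure Ω)
    (x : ℤ → Ω → Fin p → ℝ) (τ : ℕ) (j : Fin p) : ℝ :=
  (∫ ω, x 0 ω j ^ 2 * x (τ : ℤ) ω j ^ 2 ∂P) - 1

/-- The denominator in the expansion of `γ̂_{jl}`, as a function of the arrays `μ`, `ν`. -/
def denom {p : ℕ} (b : ℝ) (T₁ T₂ : Finset ℕ) (μ ν : ℕ → Fin p → ℝ) (j l : Fin p) : ℝ :=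
  2 * b * ∑ τ ∈ T₁, (μ τ j - μ τ l) ^ 2
    + 4 * (1 - b) * ∑ τ ∈ T₂,
        (ν τ j ^ 2 + ν τ l ^ 2 - 2 * (ν τ j + ν τ l) * μ τ j * μ τ l)

/-- The coefficient of `√n Ŝ_{jl}` in the expansion of `γ̂_{jl}`. -/
def covCoeff {p : ℕ} (b : ℝ) (T₁ T₂ : Finset ℕ) (μ ν : ℕ → Fin p → ℝ) (j l : Fin p) : ℝ :=
  2 * b * ∑ τ ∈ T₁, μ τ j * (μ τ l - μ τ j)
    + 4 * (1 - b) * ∑ τ ∈ T₂,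
        (ν τ l - ν τ j * (ν τ j + 1) + 2 * ν τ l * μ τ j * μ τ l)

/-! ### Sample quantities, for one realization `y` of the series -/

/-- `n⁻¹ ∑_{t = 1}^{n - τ} f t` (an empty sum when `n ≤ τ`). -/
def lagMean (n τ : ℕ) (f : ℤ → ℝ) : ℝ :=
  (n : ℝ)⁻¹ * ∑ t ∈ Finset.Icc 1 (n - τ), f (t : ℤ)

/-- Sample mean vector of `y_1, …, y_n`. -/
def sampleMean {p : ℕ} (n : ℕ) (y : ℤ → Fin p → ℝ) (j : Fin p) : ℝ :=
  lagMean n 0 (fun t => y t j)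

/-- Sample covariance matrix `Ŝ` of `y_1, …, y_n`. -/
def sampleCov {p : ℕ} (n : ℕ) (y : ℤ → Fin p → ℝ) : Matrix (Fin p) (Fin p) ℝ :=
  Matrix.of fun j l =>
    lagMean n 0 (fun t => (y t j - sampleMean n y j) * (y t l - sampleMean n y l))

/-- The linear part of `T̂(γ)`. -/
def Ts {p : ℕ} (T₁ : Finset ℕ) (n : ℕ) (y : ℤ → Fin p → ℝ) (γ : Fin p → ℝ) (i : Fin p) : ℝ :=
  ∑ τ ∈ T₁,
    lagMean n τ (fun t => (γ ⬝ᵥ y t) * (γ ⬝ᵥ y (t + τ)))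
      * lagMean n τ (fun t => (γ ⬝ᵥ y (t + τ)) * y t i + (γ ⬝ᵥ y t) * y (t + τ) i)

/-- The quadratic part of `T̂(γ)`. -/
def Tv {p : ℕ} (T₂ : Finset ℕ) (n : ℕ) (y : ℤ → Fin p → ℝ) (γ : Fin p → ℝ) (i : Fin p) : ℝ :=
  2 * ∑ τ ∈ T₂,
    lagMean n τ (fun t => (γ ⬝ᵥ y t) ^ 2 * (γ ⬝ᵥ y (t + τ)) ^ 2 - 1)
      * lagMean n τ (fun t => (γ ⬝ᵥ y t) * (γ ⬝ᵥ y (t + τ)) ^ 2 * y t i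
          + (γ ⬝ᵥ y t) ^ 2 * (γ ⬝ᵥ y (t + τ)) * y (t + τ) i)

/-- `T̂(γ) = b T̂ˢ(γ) + (1 - b) T̂ᵛ(γ)`. -/
def That {p : ℕ} (b : ℝ) (T₁ T₂ : Finset ℕ) (n : ℕ) (y : ℤ → Fin p → ℝ)
    (γ : Fin p → ℝ) (i : Fin p) : ℝ :=
  b * Ts T₁ n y γ i + (1 - b) * Tv T₂ n y γ i

/-- `T_j = T̂(e_j)`. -/
def Tvec {p : ℕ} (b : ℝ) (T₁ T₂ : Finset ℕ) (n : ℕ) (y : ℤ → Fin p → ℝ) (j : Fin p) :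
    Fin p → ℝ :=
  That b T₁ T₂ n y (Pi.single j 1)

/-- The sample estimating equations: with `γ_j` the `j`-th row of `Γ`,
`γ_jᵀ T̂(γ_l) = γ_lᵀ T̂(γ_j)` and `γ_jᵀ Ŝ γ_l = δ_{jl}` for all `j`, `l`. -/
def SolvesEstEq {p : ℕ} (b : ℝ) (T₁ T₂ : Finset ℕ) (n : ℕ) (y : ℤ → Fin p → ℝ)
    (Γ : Matrix (Fin p) (Fin p) ℝ) : Prop :=
  (∀ j l, Γ j ⬝ᵥ That b T₁ T₂ n y (Γ l) = Γ l ⬝ᵥ That b T₁ T₂ n y (Γ j)) ∧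
  (∀ j l, Γ j ⬝ᵥ (sampleCov n y).mulVec (Γ l) = if j = l then 1 else 0)

/-! ### Asymptotic notions -/

/-- `X_n = O_p(1)`. -/
def BddInProb {Ω : Type*} [MeasurableSpace Ω] (P : Measure Ω) (X : ℕ → Ω → ℝ) : Prop :=
  ∀ ε : ℝ≥0∞, 0 < ε → ∃ M : ℝ, ∀ᶠ n in atTop, P {ω | M < |X n ω|} ≤ ε

/-- `Γ̂_n` is a gSOBI estimator based on `x_1, …, x_n`, the signs and the order of its rows being
fixed by the requirement that it lies within `r` of the identity: with probability tending to one
it solves the estimating equations and all its entries are within `r` of those of `I_p`. (The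
equations are invariant under signed permutations of the rows, so they never determine `Γ̂_n`
without such a choice.) -/
def IsEstimator {Ω : Type*} [MeasurableSpace Ω] {p : ℕ} (P : Measure Ω) (b : ℝ)
    (T₁ T₂ : Finset ℕ) (x : ℤ → Ω → Fin p → ℝ) (r : ℝ)
    (Γ : ℕ → Ω → Matrix (Fin p) (Fin p) ℝ) : Prop :=
  Tendsto (fun n => P {ω | ¬ (SolvesEstEq b T₁ T₂ n (fun t => x t ω) (Γ n ω) ∧
      ∀ i j, |Γ n ω i j - (1 : Matrix (Fin p) (Fin p) ℝ) i j| ≤ r)}) atTop (𝓝 0)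

end GSOBI

end

/-! The statistics `T̂` and `Ŝ` depend on the data only through finitely many lagged sample moments
`m`, and the estimating equations read `F(m, Γ) = 0` with `F` polynomial (`momentEq`). The mean
ergodic theorem gives `m → m₀` in probability, and `F(m₀, I) = 0` because the components are centred
and independent. The rest is finite-dimensional calculus near `(m₀, I)`.

The equations split into a part antisymmetric in `(j, l)` and, `Ŝ` being symmetric, a symmetric
part. Their sum is a system of `p²` equations in `p²` unknowns from which both parts can be
recovered. Its linearization in `Γ` is `L(Δ)_{jl} = c_{jl} Δ_{lj} - c_{lj} Δ_{jl} + Δ_{jl} + Δ_{lj}`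
(`IsPopulation.linearization_apply`). On the kernel the symmetric part forces `Δ_{lj} = -Δ_{jl}`;
the antisymmetric part then becomes `D_{jl} Δ_{jl} = 0`, because `D_{jl} = -c_{jl} - c_{lj}`. So
(A3) makes `L` invertible, and the implicit function theorem yields a locally unique root `φ(m)`,
continuous in `m`. This gives existence, measurability and consistency
(`IsPopulation.exists_local_solution`).

For the expansion, strict differentiability compares `F(m, Γ̂) = 0` with `F(m, I)` at the same `m`,
so that `F(m, I) + L(Γ̂ - I) = o(‖F(m, I)‖)` with no rate for `Γ̂` or `m` known beforehand
(`IsPopulation.isLittleO_of_solution`). The entries of `F(m, I)` are `e_jᵀT_l - e_lᵀT_j + Ŝ_{jl} -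
δ_{jl}`, which is why root-n bounds are needed only for these statistics. Solving the 2 × 2 system
of the entries `jl` and `lj` gives the formulas.

Convergence in probability is expressed as convergence along one filter on `ℕ × Ω`, so that
continuous mapping and `o`/`O` calculus apply directly. -/

noncomputable section

namespace GSOBI

/-! ### Convergence in probability as convergence along a filter -/

/-- The filter of events `A ⊆ ℕ × Ω` whose sections `A n` have probability tending to one. -/
def probFilter {Ω : Type*} [MeasurableSpace Ω] (P : Measure Ω) : Filter (ℕ × Ω) where
  sets := {A | Tendsto (fun n => P {ω | (n, ω) ∉ A}) atTop (𝓝 0)}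
  univ_sets := by simp
  sets_of_superset := by
    intro A B hA hAB
    refine tendsto_of_tendsto_of_tendsto_of_le_of_le tendsto_const_nhds hA
      (fun _ => zero_le) fun n => measure_mono fun ω hω h => hω (hAB h)
  inter_sets := by
    intro A B hA hB
    have h := Tendsto.add hA hB
    rw [add_zero] at h
    refine tendsto_of_tendsto_of_tendsto_of_le_of_le tendsto_const_nhds h
      (fun _ => zero_le) fun n => ?_
    refine (measure_mono fun ω hω => ?_).trans (measure_union_le _ _)
    by_contra hc
    simp only [Set.mem_union, Set.mem_ofPred_eq, not_or, not_not] at hc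
    exact hω ⟨hc.1, hc.2⟩

section

variable {Ω : Type*} [MeasurableSpace Ω] {P : Measure Ω}

theorem eventually_probFilter {q : ℕ × Ω → Prop} :
    (∀ᶠ z in probFilter P, q z) ↔ Tendsto (fun n => P {ω | ¬ q (n, ω)}) atTop (𝓝 0) :=
  Iff.rfl

theorem tendsto_fst_probFilter : Tendsto Prod.fst (probFilter P) atTop := by
  intro s hs
  refine tendsto_const_nhds.congr' ?_
  filter_upwards [hs] with n hn
  simp [hn]

theorem tendsto_probFilter_iff_tendstoInMeasure {E : Type*} [PseudoMetricSpace E]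
    {f : ℕ → Ω → E} {c : E} :
    Tendsto (fun z : ℕ × Ω => f z.1 z.2) (probFilter P) (𝓝 c) ↔
      TendstoInMeasure P f atTop (fun _ => c) := by
  rw [tendstoInMeasure_iff_dist, Metric.tendsto_nhds]
  refine forall_congr' fun ε => forall_congr' fun _ => ?_
  rw [eventually_probFilter]
  simp only [not_lt]

/-- A negligible quantity times a quantity bounded in probability is negligible. -/
theorem tendsto_zero_of_isLittleO_bddInProb {E F : Type*} [NormedAddCommGroup E]
    [NormedAddCommGroup F] {u : ℕ × Ω → E} {v : ℕ × Ω → F} {a : ℕ → ℝ} (ha : ∀ n, 0 ≤ a n)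
    (huv : u =o[probFilter P] v) (hv : BddInProb P fun n ω => a n * ‖v (n, ω)‖) :
    Tendsto (fun z => a z.1 * ‖u z‖) (probFilter P) (𝓝 0) := by
  rw [Metric.tendsto_nhds]
  intro ε hε
  rw [eventually_probFilter, ENNReal.tendsto_nhds_zero]
  intro δ hδ
  obtain ⟨M, hM⟩ := hv (δ / 2) (ENNReal.half_pos hδ.ne')
  -- `M` may be negative or zero; `|M| + 1` is a positive bound in every case, and the factor 2
  -- makes the final inequality strict.
  have hpos : 0 < ε / (2 * (|M| + 1)) := by positivity
  have hu := (Asymptotics.isLittleO_iff.1 huv) hpos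
  rw [eventually_probFilter, ENNReal.tendsto_nhds_zero] at hu
  filter_upwards [hM, hu _ (ENNReal.half_pos hδ.ne')] with n h₁ h₂
  rw [← ENNReal.add_halves δ]
  refine le_trans (measure_mono fun ω hω => ?_) ((measure_union_le _ _).trans (add_le_add h₁ h₂))
  by_contra hc
  simp only [Set.mem_union, Set.mem_ofPred_eq, not_or, not_not, not_lt] at hc
  apply hω
  obtain ⟨h₁, h₂⟩ := hc
  rw [abs_of_nonneg (mul_nonneg (ha n) (norm_nonneg _))] at h₁
  rw [Real.dist_0_eq_abs, abs_of_nonneg (mul_nonneg (ha n) (norm_nonneg _))]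
  calc a n * ‖u (n, ω)‖ ≤ a n * (ε / (2 * (|M| + 1)) * ‖v (n, ω)‖) :=
        mul_le_mul_of_nonneg_left h₂ (ha n)
    _ = ε / (2 * (|M| + 1)) * (a n * ‖v (n, ω)‖) := by ring
    _ ≤ ε / (2 * (|M| + 1)) * (|M| + 1) := by
        refine mul_le_mul_of_nonneg_left ?_ hpos.le
        linarith [le_abs_self M]
    _ = ε / 2 := by field_simp
    _ < ε := by linarith

theorem BddInProb.mono {X Y : ℕ → Ω → ℝ} (hY : BddInProb P Y)
    (h : ∀ n ω, |X n ω| ≤ |Y n ω|) : BddInProb P X := by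
  intro ε hε
  obtain ⟨M, hM⟩ := hY ε hε
  refine ⟨M, hM.mono fun n hn => (measure_mono fun ω hω => ?_).trans hn⟩
  exact lt_of_lt_of_le hω (h n ω)

theorem BddInProb.add {X Y : ℕ → Ω → ℝ} (hX : BddInProb P X) (hY : BddInProb P Y) :
    BddInProb P fun n ω => X n ω + Y n ω := by
  intro ε hε
  obtain ⟨M, hM⟩ := hX (ε / 2) (ENNReal.half_pos hε.ne')
  obtain ⟨N, hN⟩ := hY (ε / 2) (ENNReal.half_pos hε.ne')
  refine ⟨M + N, ?_⟩
  filter_upwards [hM, hN] with n h₁ h₂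
  rw [← ENNReal.add_halves ε]
  refine le_trans (measure_mono fun ω hω => ?_) ((measure_union_le _ _).trans (add_le_add h₁ h₂))
  by_contra hc
  simp only [Set.mem_union, Set.mem_ofPred_eq, not_or, not_lt] at hc hω
  linarith [abs_add_le (X n ω) (Y n ω)]

theorem BddInProb.sum {ι : Type*} {X : ι → ℕ → Ω → ℝ} (s : Finset ι)
    (hX : ∀ i ∈ s, BddInProb P (X i)) : BddInProb P fun n ω => ∑ i ∈ s, X i n ω := by
  classical
  induction s using Finset.induction_on with
  | empty => exact fun ε hε => ⟨0, by simp⟩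
  | insert i s hi ih =>
    simp only [Finset.sum_insert hi]
    exact (hX i (Finset.mem_insert_self i s)).add
      (ih fun k hk => hX k (Finset.mem_insert_of_mem hk))

end

/-! ### The mean ergodic theorem in `L¹` -/

section

variable {α : Type*} [MeasurableSpace α] {μ : Measure α} {S : α → α}

theorem integrable_birkhoffAverage (hS : MeasurePreserving S μ μ) {f : α → ℝ}
    (hf : Integrable f μ) (n : ℕ) : Integrable (birkhoffAverage ℝ S f n) μ := by
  have : birkhoffAverage ℝ S f n = fun x => (n : ℝ)⁻¹ * ∑ k ∈ Finset.range n, f (S^[k] x) := rfl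
  rw [this]
  exact (integrable_finsetSum _ fun k _ =>
    (hS.iterate k).integrable_comp_of_integrable hf).const_mul _

/-- Each `f ∘ S^[k]` has the same `L¹` norm as `f`. This contraction carries the ergodic theorem
from `L²` over to `L¹` by density. -/
theorem eLpNorm_birkhoffAverage_le (hS : MeasurePreserving S μ μ) {f : α → ℝ}
    (hf : Integrable f μ) (n : ℕ) : eLpNorm (birkhoffAverage ℝ S f n) 1 μ ≤ eLpNorm f 1 μ := by
  have h₁ : birkhoffAverage ℝ S f n = (n : ℝ)⁻¹ • ∑ k ∈ Finset.range n, f ∘ S^[k] := by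
    ext x; simp [birkhoffAverage, birkhoffSum]
  have h₂ : eLpNorm (∑ k ∈ Finset.range n, f ∘ S^[k]) 1 μ ≤ n * eLpNorm f 1 μ := by
    refine (eLpNorm_sum_le (fun k _ => hf.aestronglyMeasurable.comp_measurePreserving
      (hS.iterate k)) le_rfl).trans ?_
    rw [Finset.sum_congr rfl fun k _ =>
      eLpNorm_comp_measurePreserving hf.aestronglyMeasurable (hS.iterate k)]
    simp
  rcases Nat.eq_zero_or_pos n with rfl | hn
  · simp
  rw [h₁, eLpNorm_const_smul]
  refine (mul_le_mul_right h₂ _).trans ?_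
  rw [← mul_assoc]
  have : ‖(n : ℝ)⁻¹‖ₑ * (n : ℝ≥0∞) = 1 := by
    rw [enorm_inv (by positivity)]
    have : ‖(n : ℝ)‖ₑ = n := by simp
    rw [this]
    exact ENNReal.inv_mul_cancel (by simpa using hn.ne') (by simp)
  rw [this, one_mul]

/-- Von Neumann's theorem for an ergodic map and a square integrable function. -/
theorem tendsto_eLpNorm_two_birkhoffAverage [IsProbabilityMeasure μ] (hS : Ergodic S μ)
    {f : α → ℝ} (hf : MemLp f 2 μ) :
    Tendsto (fun n => eLpNorm (fun x => birkhoffAverage ℝ S f n x - ∫ y, f y ∂μ) 2 μ)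
      atTop (𝓝 0) := by
  set U : Lp ℝ 2 μ →ₗᵢ[ℝ] Lp ℝ 2 μ :=
    Lp.compMeasurePreservingₗᵢ ℝ S hS.toMeasurePreserving with hU
  set F : Lp ℝ 2 μ := hf.toLp f with hF
  set V : Submodule ℝ (Lp ℝ 2 μ) :=
    (U.toContinuousLinearMap).eqLocus (1 : Lp ℝ 2 μ →L[ℝ] Lp ℝ 2 μ) with hV
  have hlim := ContinuousLinearMap.tendsto_birkhoffAverage_orthogonalProjection
    U.toContinuousLinearMap U.norm_toContinuousLinearMap_le F
  set G : Lp ℝ 2 μ := ((V.orthogonalProjectionOnto F : V) : Lp ℝ 2 μ) with hG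
  have hfix : U G = G := (V.orthogonalProjectionOnto F).2
  have hone : MemLp (fun _ : α => (1 : ℝ)) 2 μ := memLp_const 1
  have hU1 : U (hone.toLp _) = hone.toLp _ := by
    change Lp.compMeasurePreserving S hS.toMeasurePreserving (hone.toLp _) = _
    rw [Lp.toLp_compMeasurePreserving]
    rfl
  -- The limit `G` is the projection onto the invariant functions, which ergodicity reduces to
  -- constants. The function 1 is itself invariant, hence orthogonal to `F - G`, and this identifies
  -- the constant as the mean of `f`.
  obtain ⟨c, hc⟩ : ∃ c, (G : α → ℝ) =ᵐ[μ] Function.const α c := by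
    refine hS.ae_eq_const_of_ae_eq_comp_ae (Lp.aestronglyMeasurable G) ?_
    have h := Lp.coeFn_compMeasurePreserving G hS.toMeasurePreserving
    have h' : Lp.compMeasurePreserving S hS.toMeasurePreserving G = G := hfix
    rw [h'] at h
    exact h.symm
  have hcf : c = ∫ y, f y ∂μ := by
    have hperp : inner ℝ (F - G) (hone.toLp _) = 0 :=
      V.starProjection_inner_eq_zero F _ hU1
    rw [inner_sub_left, sub_eq_zero, L2.inner_def, L2.inner_def] at hperp
    have h₁ : ∫ a, inner ℝ (F a) (hone.toLp _ a) ∂μ = ∫ y, f y ∂μ := by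
      refine integral_congr_ae ?_
      filter_upwards [hf.coeFn_toLp] with a h
      simp [hF, h]
    have h₂ : ∫ a, inner ℝ (G a) (hone.toLp _ a) ∂μ = c := by
      rw [integral_congr_ae (g := fun _ => c)]
      · simp
      filter_upwards [hc] with a h
      simp [h]
    rw [← h₁, hperp, h₂]
  have hcoe : ∀ n, (birkhoffAverage ℝ U.toContinuousLinearMap _root_.id n F : Lp ℝ 2 μ)
      =ᵐ[μ] birkhoffAverage ℝ S f n := by
    intro n
    have hit : ∀ k, (U.toContinuousLinearMap^[k] F : Lp ℝ 2 μ) =ᵐ[μ] f ∘ S^[k] := by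
      intro k
      have h : U.toContinuousLinearMap^[k] F
          = Lp.compMeasurePreserving S^[k] (hS.toMeasurePreserving.iterate k) F := by
        have := congrFun (Lp.compMeasurePreserving_iterate (E := ℝ) (p := 2)
          hS.toMeasurePreserving k) F
        exact this
      rw [h, hF, Lp.toLp_compMeasurePreserving]
      exact MemLp.coeFn_toLp _
    have hsum : (∑ k ∈ Finset.range n, (U.toContinuousLinearMap^[k] F) : Lp ℝ 2 μ)
        =ᵐ[μ] ∑ k ∈ Finset.range n, f ∘ S^[k] := by
      induction n with
      | zero => simpa using Lp.coeFn_zero ℝ 2 μ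
      | succ n ih =>
        rw [Finset.sum_range_succ, Finset.sum_range_succ]
        exact (Lp.coeFn_add _ _).trans (ih.add (hit n))
    have : birkhoffAverage ℝ U.toContinuousLinearMap _root_.id n F
        = (n : ℝ)⁻¹ • ∑ k ∈ Finset.range n, (U.toContinuousLinearMap^[k] F) := rfl
    rw [this]
    refine (Lp.coeFn_smul _ _).trans ?_
    filter_upwards [hsum] with a ha
    rw [Pi.smul_apply, ha]
    simp [birkhoffAverage, birkhoffSum]
  rw [Lp.tendsto_Lp_iff_tendsto_eLpNorm'] at hlim
  refine hlim.congr fun n => eLpNorm_congr_ae ?_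
  filter_upwards [hcoe n, hc] with a h h'
  rw [Pi.sub_apply, h]
  change _ - (G : α → ℝ) a = _
  rw [h', ← hcf]
  rfl

/-- The mean ergodic theorem for integrable functions. -/
theorem tendsto_eLpNorm_one_birkhoffAverage [IsProbabilityMeasure μ] (hS : Ergodic S μ)
    {f : α → ℝ} (hf : Integrable f μ) :
    Tendsto (fun n => eLpNorm (fun x => birkhoffAverage ℝ S f n x - ∫ y, f y ∂μ) 1 μ)
      atTop (𝓝 0) := by
  rw [ENNReal.tendsto_nhds_zero]
  intro ε hε
  have hε3 : ε / 3 ≠ 0 := (ENNReal.div_pos hε.ne' (by simp)).ne'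
  -- A simple function is square integrable, so von Neumann's theorem covers it. The three errors
  -- are the average of `f - g`, the deviation for `g`, and the difference of the means.
  obtain ⟨g, hg, hg'⟩ := (memLp_one_iff_integrable.2 hf).exists_simpleFunc_eLpNorm_sub_lt
    ENNReal.one_ne_top hε3
  have hgi : Integrable g μ := memLp_one_iff_integrable.1 hg'
  have hg2 : MemLp g 2 μ := g.memLp_of_isFiniteMeasure 2 μ
  have hlim := tendsto_eLpNorm_two_birkhoffAverage hS hg2
  rw [ENNReal.tendsto_nhds_zero] at hlim
  filter_upwards [hlim (ε / 3) (pos_iff_ne_zero.2 hε3)] with n hn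
  have hfg : Integrable (f - ⇑g) μ := hf.sub hgi
  have hdecomp : (fun x => birkhoffAverage ℝ S f n x - ∫ y, f y ∂μ)
      = (birkhoffAverage ℝ S (f - ⇑g) n + fun x => birkhoffAverage ℝ S g n x - ∫ y, g y ∂μ)
        + fun _ => (∫ y, g y ∂μ) - ∫ y, f y ∂μ := by
    rw [birkhoffAverage_sub]
    ext x
    simp only [Pi.add_apply, Pi.sub_apply]
    ring
  have hm₁ := (integrable_birkhoffAverage hS.toMeasurePreserving hfg n).aestronglyMeasurable
  have hm₂ : AEStronglyMeasurable (fun x => birkhoffAverage ℝ S g n x - ∫ y, g y ∂μ) μ :=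
    ((integrable_birkhoffAverage hS.toMeasurePreserving hgi n).sub
      (integrable_const _)).aestronglyMeasurable
  have h₁ : eLpNorm (birkhoffAverage ℝ S (f - ⇑g) n) 1 μ ≤ ε / 3 :=
    (eLpNorm_birkhoffAverage_le hS.toMeasurePreserving hfg n).trans hg.le
  have h₂ : eLpNorm (fun x => birkhoffAverage ℝ S g n x - ∫ y, g y ∂μ) 1 μ ≤ ε / 3 :=
    (eLpNorm_le_eLpNorm_of_exponent_le (by norm_num) hm₂).trans hn
  have h₃ : eLpNorm (fun _ : α => (∫ y, g y ∂μ) - ∫ y, f y ∂μ) 1 μ ≤ ε / 3 := by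
    rw [← integral_sub hgi hf, eLpNorm_const _ one_ne_zero (NeZero.ne μ)]
    simp only [measure_univ, ENNReal.one_rpow, mul_one]
    refine (enorm_integral_le_lintegral_enorm _).trans ?_
    have : ∫⁻ a, ‖g a - f a‖ₑ ∂μ = eLpNorm (f - ⇑g) 1 μ := by
      rw [eLpNorm_one_eq_lintegral_enorm]
      refine lintegral_congr fun a => ?_
      rw [Pi.sub_apply, ← enorm_neg, neg_sub]
    rw [this]
    exact hg.le
  rw [hdecomp]
  calc _ ≤ _ := eLpNorm_add_le (hm₁.add hm₂) aestronglyMeasurable_const le_rfl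
    _ ≤ _ := add_le_add_left (eLpNorm_add_le hm₁ hm₂ le_rfl) _
    _ ≤ ε / 3 + ε / 3 + ε / 3 := add_le_add (add_le_add h₁ h₂) h₃
    _ = ε := ENNReal.add_thirds ε

end

/-! ### The law of large numbers for lagged sample moments -/

theorem iterate_shift {β : Type*} (y : ℤ → β) (k : ℕ) :
    (fun (y : ℤ → β) (t : ℤ) => y (t + 1))^[k] y = fun t => y (t + k) := by
  induction k with
  | zero => simp
  | succ k ih =>
    rw [Function.iterate_succ_apply', ih]
    ext t
    change y (t + 1 + k) = _
    congr 1
    push_cast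
    ring

/-- Two offsets separate a lagged mean from a Birkhoff average: it divides `n - τ` terms by `n`,
whence the factor, and it starts at `t = 1`, whence the shifted path. -/
theorem lagMean_shift_eq {β : Type*} (g : (ℤ → β) → ℝ) (n τ : ℕ) (y : ℤ → β) :
    lagMean n τ (fun t => g fun s => y (s + t)) = ((n - τ : ℕ) : ℝ) / n *
      birkhoffAverage ℝ (fun (y : ℤ → β) (t : ℤ) => y (t + 1)) g (n - τ) (fun t => y (t + 1)) := by
  set N := n - τ with hN
  have hsum : ∑ t ∈ Finset.Icc 1 N, g (fun s => y (s + (t : ℤ)))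
      = birkhoffSum (fun (y : ℤ → β) (t : ℤ) => y (t + 1)) g N (fun t => y (t + 1)) := by
    rw [birkhoffSum, Finset.range_eq_Ico, Finset.sum_Ico_eq_sum_range,
      ← Finset.Ico_add_one_right_eq_Icc, Finset.sum_Ico_eq_sum_range]
    refine Finset.sum_congr (by simp) fun k _ => ?_
    rw [iterate_shift]
    congr 1
    ext s
    congr 1
    push_cast
    ring
  rw [lagMean, ← hN, hsum, birkhoffAverage, smul_eq_mul, ← mul_assoc]
  rcases Nat.eq_zero_or_pos N with h | h
  · simp [h]
  · congr 1
    field_simp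

theorem tendsto_natCast_sub_div (τ : ℕ) :
    Tendsto (fun n : ℕ => ((n - τ : ℕ) : ℝ) / n) atTop (𝓝 1) := by
  have h : Tendsto (fun n : ℕ => 1 - (τ : ℝ) / n) atTop (𝓝 (1 - 0)) :=
    tendsto_const_nhds.sub (tendsto_const_div_atTop_nhds_zero_nat _)
  rw [sub_zero] at h
  refine h.congr' ?_
  filter_upwards [eventually_ge_atTop (τ + 1)] with n hn
  have : (n : ℝ) ≠ 0 := by
    have : 0 < n := by omega
    positivity
  rw [Nat.cast_sub (by omega)]
  field_simp

/-- Only integrability of `g` is available in the application to products of four coordinates with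
finite fourth moments, so the `L¹` form of the ergodic theorem is essential. -/
theorem tendsto_lagMean {Ω : Type*} [MeasurableSpace Ω] {P : Measure Ω} [IsProbabilityMeasure P]
    {p : ℕ} {x : ℤ → Ω → Fin p → ℝ} (hmeas : ∀ t, Measurable (x t))
    (herg : Ergodic (fun (y : ℤ → Fin p → ℝ) (t : ℤ) => y (t + 1))
      (P.map (fun ω (t : ℤ) => x t ω)))
    (τ : ℕ) {g : (ℤ → Fin p → ℝ) → ℝ} (hg : Measurable g)
    (hint : Integrable (fun ω => g fun t => x t ω) P) :
    Tendsto (fun z : ℕ × Ω => lagMean z.1 τ fun t => g fun s => x (s + t) z.2) (probFilter P)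
      (𝓝 (∫ ω, g (fun t => x t ω) ∂P)) := by
  set S : (ℤ → Fin p → ℝ) → (ℤ → Fin p → ℝ) := fun y t => y (t + 1) with hS
  have hX : Measurable (fun ω (t : ℤ) => x t ω) := measurable_pi_lambda _ hmeas
  set Q := P.map (fun ω (t : ℤ) => x t ω) with hQ
  have : IsProbabilityMeasure Q := Measure.isProbabilityMeasure_map hX.aemeasurable
  have hgQ : Integrable g Q :=
    (integrable_map_measure hg.aestronglyMeasurable hX.aemeasurable).2 hint
  have hgE : ∫ ω, g (fun t => x t ω) ∂P = ∫ y, g y ∂Q :=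
    (integral_map hX.aemeasurable hg.aestronglyMeasurable).symm
  have hSX : MeasurePreserving (fun ω => S fun t => x t ω) P Q :=
    herg.toMeasurePreserving.comp ⟨hX, rfl⟩
  have hsub : Tendsto (fun n : ℕ => n - τ) atTop atTop := tendsto_sub_atTop_nat τ
  have havg : Tendsto (fun z : ℕ × Ω => birkhoffAverage ℝ S g (z.1 - τ) (S fun t => x t z.2))
      (probFilter P) (𝓝 (∫ y, g y ∂Q)) := by
    rw [tendsto_probFilter_iff_tendstoInMeasure
      (f := fun n ω => birkhoffAverage ℝ S g (n - τ) (S fun t => x t ω))]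
    have hm : ∀ n, AEStronglyMeasurable (birkhoffAverage ℝ S g n) Q := fun n =>
      (integrable_birkhoffAverage herg.toMeasurePreserving hgQ n).aestronglyMeasurable
    refine tendstoInMeasure_of_tendsto_eLpNorm one_ne_zero
      (fun n => (hm _).comp_measurePreserving hSX) aestronglyMeasurable_const ?_
    refine ((tendsto_eLpNorm_one_birkhoffAverage herg hgQ).comp hsub).congr fun n => ?_
    exact (eLpNorm_comp_measurePreserving ((hm _).sub aestronglyMeasurable_const) hSX).symm
  rw [hgE]
  have := ((tendsto_natCast_sub_div τ).comp (tendsto_fst_probFilter (P := P))).mul havg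
  rw [one_mul] at this
  refine this.congr fun z => ?_
  rw [lagMean_shift_eq g z.1 τ fun t => x t z.2]
  rfl

/-! ### The estimating equations as polynomial equations in moments -/

/-- Values of the moments entering the estimating equations: lagged second moments, lagged fourth
moments, lagged means of the constant `1`, and the covariance matrix. -/
abbrev Moments (p : ℕ) (T₁ T₂ : Finset ℕ) : Type :=
  (T₁ → Fin p → Fin p → ℝ) × (T₂ → Fin p → Fin p → Fin p → Fin p → ℝ) × (T₂ → ℝ) ×
    (Fin p → Fin p → ℝ)

section

variable {p : ℕ} {T₁ T₂ : Finset ℕ}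

/-- Linear autocorrelation of the projection `γᵀ x`. -/
def linA (M : Fin p → Fin p → ℝ) (γ : Fin p → ℝ) : ℝ :=
  γ ⬝ᵥ fun i => γ ⬝ᵥ fun k => M i k

/-- The gradient of the linear autocorrelation `linA`. -/
def linB (M : Fin p → Fin p → ℝ) (γ : Fin p → ℝ) (i : Fin p) : ℝ :=
  (γ ⬝ᵥ fun k => M i k) + γ ⬝ᵥ fun k => M k i

/-- Quadratic autocorrelation of the projection `γᵀ x`, `c` being subtracted. -/
def quadA (Q : Fin p → Fin p → Fin p → Fin p → ℝ) (c : ℝ) (γ : Fin p → ℝ) : ℝ :=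
  (γ ⬝ᵥ fun a₁ => γ ⬝ᵥ fun a₂ => γ ⬝ᵥ fun a₃ => γ ⬝ᵥ fun a₄ => Q a₁ a₂ a₃ a₄) - c

/-- Half the gradient of the quadratic autocorrelation `quadA`, for the symmetries of fourth
moments. -/
def quadB (Q : Fin p → Fin p → Fin p → Fin p → ℝ) (γ : Fin p → ℝ) (i : Fin p) : ℝ :=
  (γ ⬝ᵥ fun a₁ => γ ⬝ᵥ fun a₂ => γ ⬝ᵥ fun a₃ => Q a₁ i a₂ a₃)
    + γ ⬝ᵥ fun a₁ => γ ⬝ᵥ fun a₂ => γ ⬝ᵥ fun a₃ => Q a₁ a₂ a₃ i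

/-- `T̂(γ)` as a function of the moments. -/
def momentT (b : ℝ) (m : Moments p T₁ T₂) (γ : Fin p → ℝ) (i : Fin p) : ℝ :=
  b * ∑ τ : T₁, linA (m.1 τ) γ * linB (m.1 τ) γ i
    + (1 - b) * (2 * ∑ τ : T₂, quadA (m.2.1 τ) (m.2.2.1 τ) γ * quadB (m.2.1 τ) γ i)

/-- The antisymmetric part of the estimating equations. -/
def antiEq (b : ℝ) (m : Moments p T₁ T₂) (Γ : Fin p → Fin p → ℝ) (j l : Fin p) : ℝ :=
  Γ j ⬝ᵥ momentT b m (Γ l) - Γ l ⬝ᵥ momentT b m (Γ j)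

/-- The symmetric part of the estimating equations. -/
def symmEq (m : Moments p T₁ T₂) (Γ : Fin p → Fin p → ℝ) (j l : Fin p) : ℝ :=
  (Γ j ⬝ᵥ fun i => m.2.2.2 i ⬝ᵥ Γ l) - if j = l then 1 else 0

/-- Both parts of the estimating equations in one square system. -/
def momentEq (b : ℝ) (u : Moments p T₁ T₂ × (Fin p → Fin p → ℝ)) (j l : Fin p) : ℝ :=
  antiEq b u.1 u.2 j l + symmEq u.1 u.2 j l

/-- Sample moments of `y_1, …, y_n`. -/
def sampleMoments (T₁ T₂ : Finset ℕ) (n : ℕ) (y : ℤ → Fin p → ℝ) : Moments p T₁ T₂ :=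
  (fun τ i k => lagMean n τ fun t => y t i * y (t + (τ : ℕ)) k,
    fun τ i k u v => lagMean n τ fun t => y t i * y t k * (y (t + (τ : ℕ)) u * y (t + (τ : ℕ)) v),
    fun τ => lagMean n τ fun _ => 1,
    fun i k => sampleCov n y i k)

theorem antiEq_swap (b : ℝ) (m : Moments p T₁ T₂) (Γ : Fin p → Fin p → ℝ) (j l : Fin p) :
    antiEq b m Γ l j = -antiEq b m Γ j l := by
  simp [antiEq]

theorem symmEq_swap {m : Moments p T₁ T₂} (hm : ∀ i k, m.2.2.2 i k = m.2.2.2 k i)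
    (Γ : Fin p → Fin p → ℝ) (j l : Fin p) :
    symmEq m Γ l j = symmEq m Γ j l := by
  simp only [symmEq, eq_comm (a := l), dotProduct, Finset.mul_sum]
  rw [Finset.sum_comm]
  congr 1
  refine Finset.sum_congr rfl fun i _ => Finset.sum_congr rfl fun k _ => ?_
  rw [hm]
  ring

/-- Together with its companion for `symmEq`, this shows that adding the two parts into one system
loses no equation. -/
theorem antiEq_eq_of_symm (b : ℝ) {m : Moments p T₁ T₂}
    (hm : ∀ i k, m.2.2.2 i k = m.2.2.2 k i) (Γ : Fin p → Fin p → ℝ) (j l : Fin p) :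
    antiEq b m Γ j l = (momentEq b (m, Γ) j l - momentEq b (m, Γ) l j) / 2 := by
  simp only [momentEq]
  rw [antiEq_swap b m Γ j l, symmEq_swap hm Γ j l]
  ring

theorem symmEq_eq_of_symm (b : ℝ) {m : Moments p T₁ T₂}
    (hm : ∀ i k, m.2.2.2 i k = m.2.2.2 k i) (Γ : Fin p → Fin p → ℝ) (j l : Fin p) :
    symmEq m Γ j l = (momentEq b (m, Γ) j l + momentEq b (m, Γ) l j) / 2 := by
  simp only [momentEq]
  rw [antiEq_swap b m Γ j l, symmEq_swap hm Γ j l]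
  ring

theorem sampleCov_symm (n : ℕ) (y : ℤ → Fin p → ℝ) (i k : Fin p) :
    sampleCov n y i k = sampleCov n y k i := by
  simp only [sampleCov, Matrix.of_apply, mul_comm]

theorem lagMean_dotProduct (n τ : ℕ) (γ : Fin p → ℝ) (f : ℤ → Fin p → ℝ) :
    lagMean n τ (fun t => γ ⬝ᵥ f t) = γ ⬝ᵥ fun a => lagMean n τ fun t => f t a := by
  simp only [lagMean, dotProduct, Finset.mul_sum]
  rw [Finset.sum_comm]
  refine Finset.sum_congr rfl fun a _ => Finset.sum_congr rfl fun t _ => by ring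

theorem lagMean_add (n τ : ℕ) (f g : ℤ → ℝ) :
    lagMean n τ (fun t => f t + g t) = lagMean n τ f + lagMean n τ g := by
  simp only [lagMean, Finset.sum_add_distrib, mul_add]

theorem lagMean_sub (n τ : ℕ) (f g : ℤ → ℝ) :
    lagMean n τ (fun t => f t - g t) = lagMean n τ f - lagMean n τ g := by
  simp only [lagMean, Finset.sum_sub_distrib, mul_sub]

theorem lagMean_congr {n τ : ℕ} {f g : ℤ → ℝ}
    (h : ∀ t : ℤ, 1 ≤ t → t + τ ≤ n → f t = g t) : lagMean n τ f = lagMean n τ g := by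
  rw [lagMean, lagMean]
  congr 1
  refine Finset.sum_congr rfl fun t ht => ?_
  rw [Finset.mem_Icc] at ht
  exact h t (by omega) (by omega)

theorem dotProduct_mul_right (γ v : Fin p → ℝ) (c : ℝ) :
    (γ ⬝ᵥ v) * c = γ ⬝ᵥ fun a => v a * c := by
  simp only [dotProduct, Finset.sum_mul, mul_assoc]

theorem mul_dotProduct (γ v : Fin p → ℝ) (c : ℝ) :
    c * (γ ⬝ᵥ v) = γ ⬝ᵥ fun a => c * v a := by
  simp only [dotProduct, Finset.mul_sum, mul_left_comm]

/-- Multilinear expansion in `γ`. The subtracted 1 in the quadratic part averages to `(n - τ)/n` for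
`τ ≤ n` and `n > 0`, not to 1; treating this mean as one more moment makes the identity exact. -/
theorem That_eq_momentT (b : ℝ) (n : ℕ) (y : ℤ → Fin p → ℝ) (γ : Fin p → ℝ) (i : Fin p) :
    That b T₁ T₂ n y γ i = momentT b (sampleMoments T₁ T₂ n y) γ i := by
  have hA₁ : ∀ τ : ℕ, lagMean n τ (fun t => (γ ⬝ᵥ y t) * (γ ⬝ᵥ y (t + τ)))
      = linA (fun i k => lagMean n τ fun t => y t i * y (t + τ) k) γ := by
    intro τ
    simp only [linA, ← lagMean_dotProduct, ← mul_dotProduct, ← dotProduct_mul_right]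
  have hB₁ : ∀ τ : ℕ,
      lagMean n τ (fun t => (γ ⬝ᵥ y (t + τ)) * y t i + (γ ⬝ᵥ y t) * y (t + τ) i)
      = linB (fun i k => lagMean n τ fun t => y t i * y (t + τ) k) γ i := by
    intro τ
    simp only [linB, ← lagMean_dotProduct, ← dotProduct_mul_right, ← lagMean_add,
      mul_comm (y _ i)]
  have hA₂ : ∀ τ : ℕ, lagMean n τ (fun t => (γ ⬝ᵥ y t) ^ 2 * (γ ⬝ᵥ y (t + τ)) ^ 2 - 1)
      = quadA (fun i k u v => lagMean n τ fun t => y t i * y t k * (y (t + τ) u * y (t + τ) v))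
          (lagMean n τ fun _ => 1) γ := by
    intro τ
    have h : ∀ t : ℤ, (γ ⬝ᵥ y t) ^ 2 * (γ ⬝ᵥ y (t + τ)) ^ 2 - 1
        = (γ ⬝ᵥ fun a₁ => γ ⬝ᵥ fun a₂ => γ ⬝ᵥ fun a₃ => γ ⬝ᵥ fun a₄ =>
          y t a₁ * y t a₂ * (y (t + τ) a₃ * y (t + τ) a₄)) - 1 := by
      intro t
      simp only [← mul_dotProduct, ← dotProduct_mul_right]
      ring
    simp only [h, quadA, lagMean_sub, lagMean_dotProduct]
  have hB₂ : ∀ τ : ℕ,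
      lagMean n τ (fun t => (γ ⬝ᵥ y t) * (γ ⬝ᵥ y (t + τ)) ^ 2 * y t i
          + (γ ⬝ᵥ y t) ^ 2 * (γ ⬝ᵥ y (t + τ)) * y (t + τ) i)
      = quadB (fun i k u v => lagMean n τ fun t => y t i * y t k * (y (t + τ) u * y (t + τ) v))
          γ i := by
    intro τ
    have h : ∀ t : ℤ, (γ ⬝ᵥ y t) * (γ ⬝ᵥ y (t + τ)) ^ 2 * y t i
          + (γ ⬝ᵥ y t) ^ 2 * (γ ⬝ᵥ y (t + τ)) * y (t + τ) i
        = (γ ⬝ᵥ fun a₁ => γ ⬝ᵥ fun a₂ => γ ⬝ᵥ fun a₃ =>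
            y t a₁ * y t i * (y (t + τ) a₂ * y (t + τ) a₃))
          + γ ⬝ᵥ fun a₁ => γ ⬝ᵥ fun a₂ => γ ⬝ᵥ fun a₃ =>
            y t a₁ * y t a₂ * (y (t + τ) a₃ * y (t + τ) i) := by
      intro t
      simp only [← mul_dotProduct, ← dotProduct_mul_right]
      ring
    simp only [h, quadB, lagMean_add, lagMean_dotProduct]
  rw [That, Ts, Tv, momentT, ← Finset.sum_coe_sort T₁, ← Finset.sum_coe_sort T₂]
  simp only [hA₁, hB₁, hA₂, hB₂, sampleMoments]

theorem Tvec_eq_momentT (b : ℝ) (n : ℕ) (y : ℤ → Fin p → ℝ) (j i : Fin p) :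
    Tvec b T₁ T₂ n y j i = momentT b (sampleMoments T₁ T₂ n y) (Pi.single j 1) i :=
  That_eq_momentT b n y _ i

theorem solvesEstEq_iff (b : ℝ) (n : ℕ) (y : ℤ → Fin p → ℝ) (Γ : Fin p → Fin p → ℝ) :
    SolvesEstEq b T₁ T₂ n y (Matrix.of Γ) ↔ momentEq b (sampleMoments T₁ T₂ n y, Γ) = 0 := by
  have hT : ∀ γ, That b T₁ T₂ n y γ = momentT b (sampleMoments T₁ T₂ n y) γ := fun γ =>
    funext fun i => That_eq_momentT b n y γ i
  have h₁ : (∀ j l, Γ j ⬝ᵥ That b T₁ T₂ n y (Γ l) = Γ l ⬝ᵥ That b T₁ T₂ n y (Γ j)) ↔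
      ∀ j l, antiEq b (sampleMoments T₁ T₂ n y) Γ j l = 0 := by
    simp only [hT, antiEq, sub_eq_zero]
  have h₂ : (∀ j l, Γ j ⬝ᵥ (sampleCov n y).mulVec (Γ l) = if j = l then 1 else 0) ↔
      ∀ j l, symmEq (sampleMoments T₁ T₂ n y) Γ j l = 0 := by
    simp only [symmEq, sub_eq_zero]
    rfl
  refine (and_congr h₁ h₂).trans ?_
  have hsymm : ∀ i k, (sampleMoments T₁ T₂ n y).2.2.2 i k
      = (sampleMoments T₁ T₂ n y).2.2.2 k i := sampleCov_symm n y
  constructor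
  · rintro ⟨ha, hs⟩
    funext j l
    simp [momentEq, ha, hs]
  · intro h
    refine ⟨fun j l => ?_, fun j l => ?_⟩
    · rw [antiEq_eq_of_symm b hsymm, h]
      simp
    · rw [symmEq_eq_of_symm b hsymm, h]
      simp

theorem sampleMoments_congr {n : ℕ} {y y' : ℤ → Fin p → ℝ}
    (h : ∀ t : ℤ, 1 ≤ t → t ≤ n → y t = y' t) :
    sampleMoments T₁ T₂ n y = sampleMoments T₁ T₂ n y' := by
  have hmean : sampleMean n y = sampleMean n y' := by
    funext j
    exact lagMean_congr fun t h₁ h₂ => by rw [h t h₁ (by push_cast at h₂; omega)]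
  simp only [sampleMoments, Prod.mk.injEq]
  refine ⟨?_, ?_, trivial, ?_⟩
  · funext τ i k
    exact lagMean_congr fun t h₁ h₂ => by rw [h t h₁ (by omega), h (t + (τ : ℕ)) (by omega) h₂]
  · funext τ i k u v
    exact lagMean_congr fun t h₁ h₂ => by rw [h t h₁ (by omega), h (t + (τ : ℕ)) (by omega) h₂]
  · funext i k
    simp only [sampleCov, Matrix.of_apply, hmean]
    exact lagMean_congr fun t h₁ h₂ => by rw [h t h₁ (by push_cast at h₂; omega)]

theorem measurable_lagMean {α : Type*} [MeasurableSpace α] (n τ : ℕ) {f : α → ℤ → ℝ}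
    (hf : ∀ t, Measurable fun a => f a t) : Measurable fun a => lagMean n τ (f a) := by
  simp only [lagMean]
  exact (Finset.measurable_fun_sum (f := fun (t : ℕ) a => f a t) _ fun t _ => hf t).const_mul _

theorem measurable_sampleMoments {α : Type*} [MeasurableSpace α] (n : ℕ)
    {y : α → ℤ → Fin p → ℝ} (hy : ∀ t i, Measurable fun a => y a t i) :
    Measurable fun a => sampleMoments T₁ T₂ n (y a) := by
  refine Measurable.prodMk ?_ (Measurable.prodMk ?_ (Measurable.prodMk ?_ ?_))
  · refine measurable_pi_lambda _ fun τ => measurable_pi_lambda _ fun i =>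
      measurable_pi_lambda _ fun k => measurable_lagMean _ _ fun t => ?_
    fun_prop
  · refine measurable_pi_lambda _ fun τ => measurable_pi_lambda _ fun i =>
      measurable_pi_lambda _ fun k => measurable_pi_lambda _ fun u =>
      measurable_pi_lambda _ fun v => measurable_lagMean _ _ fun t => ?_
    fun_prop
  · exact measurable_const
  · refine measurable_pi_lambda _ fun i => measurable_pi_lambda _ fun k => ?_
    simp only [sampleCov, Matrix.of_apply]
    refine measurable_lagMean _ _ fun t => ?_
    have hmean : ∀ j, Measurable fun a => sampleMean n (y a) j := fun j =>
      measurable_lagMean _ _ fun t => hy t j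
    fun_prop

theorem contDiff_momentEq (b : ℝ) :
    ContDiff ℝ 1 (momentEq (p := p) (T₁ := T₁) (T₂ := T₂) b) := by
  have h : ∀ j l, ContDiff ℝ 1 fun u : Moments p T₁ T₂ × (Fin p → Fin p → ℝ) =>
      momentEq b u j l := by
    intro j l
    simp only [momentEq, antiEq, symmEq, momentT, linA, linB, quadA, quadB, dotProduct]
    fun_prop
  exact contDiff_pi.2 fun j => contDiff_pi.2 fun l => h j l

end

/-! ### Linearization of the estimating equations at the identity -/

section

variable {p : ℕ} {T₁ T₂ : Finset ℕ}

/-- The population values of the moments, as far as they enter the linearization: a centred process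
with unit variances and independent components, with autocorrelations `μ` and `ν`. -/
structure IsPopulation (m : Moments p T₁ T₂) (μ ν : ℕ → Fin p → ℝ) : Prop where
  lin : ∀ τ i k, m.1 τ i k = if i = k then μ τ i else 0
  quad_self : ∀ τ l, m.2.1 τ l l l l = ν τ l + 1
  quad_left : ∀ τ j l k, j ≠ l → m.2.1 τ k j l l = if k = j then 1 else 0
  quad_right : ∀ τ j l k, j ≠ l → m.2.1 τ l l k j = if k = j then 1 else 0
  quad_cross : ∀ τ j l k, j ≠ l → m.2.1 τ l j l k = if k = j then μ τ j * μ τ l else 0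
  quad_cross' : ∀ τ j l k, j ≠ l → m.2.1 τ l k l j = if k = j then μ τ j * μ τ l else 0
  quad_swap_left : ∀ τ i k u v, m.2.1 τ i k u v = m.2.1 τ k i u v
  quad_swap_right : ∀ τ i k u v, m.2.1 τ i k u v = m.2.1 τ i k v u
  const : ∀ τ, m.2.2.1 τ = 1
  cov : ∀ i k, m.2.2.2 i k = if i = k then 1 else 0

theorem hasDerivAt_const_add_mul (c d : ℝ) : HasDerivAt (fun s : ℝ => c + s * d) d 0 := by
  simpa using ((hasDerivAt_id' (0 : ℝ)).mul_const d).const_add c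

/-- The product rule along a line through `e_l`. Iterating it differentiates the nested dot products
that make up the multilinear forms. -/
theorem hasDerivAt_line_dotProduct (l : Fin p) (δ : Fin p → ℝ) {f : ℝ → Fin p → ℝ}
    {f' : Fin p → ℝ} (hf : ∀ a, HasDerivAt (fun s => f s a) (f' a) 0) :
    HasDerivAt (fun s : ℝ => (Pi.single l 1 + s • δ) ⬝ᵥ f s) (δ ⬝ᵥ f 0 + f' l) 0 := by
  simp only [dotProduct, Pi.add_apply, Pi.smul_apply, smul_eq_mul]
  have h : ∀ a, HasDerivAt (fun s : ℝ => ((Pi.single l 1 : Fin p → ℝ) a + s * δ a) * f s a)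
      (δ a * f 0 a + (Pi.single l 1 : Fin p → ℝ) a * f' a) 0 := by
    intro a
    simpa using (hasDerivAt_const_add_mul ((Pi.single l 1 : Fin p → ℝ) a) (δ a)).fun_mul (hf a)
  refine (HasDerivAt.fun_sum fun a (_ : a ∈ Finset.univ) => h a).congr_deriv ?_
  rw [Finset.sum_add_distrib]
  simp [Pi.single_apply]

theorem linA_single (M : Fin p → Fin p → ℝ) (l : Fin p) : linA M (Pi.single l 1) = M l l := by
  simp [linA]

theorem linB_single (M : Fin p → Fin p → ℝ) (l i : Fin p) :
    linB M (Pi.single l 1) i = M i l + M l i := by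
  simp [linB]

theorem quadA_single (Q : Fin p → Fin p → Fin p → Fin p → ℝ) (c : ℝ) (l : Fin p) :
    quadA Q c (Pi.single l 1) = Q l l l l - c := by
  simp [quadA]

theorem quadB_single (Q : Fin p → Fin p → Fin p → Fin p → ℝ) (l i : Fin p) :
    quadB Q (Pi.single l 1) i = Q l i l l + Q l l l i := by
  simp [quadB]

theorem hasDerivAt_linB_line (M : Fin p → Fin p → ℝ) (l i : Fin p) (δ : Fin p → ℝ) :
    HasDerivAt (fun s : ℝ => linB M (Pi.single l 1 + s • δ) i)
      ((δ ⬝ᵥ fun k => M i k) + δ ⬝ᵥ fun k => M k i) 0 := by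
  have h₁ := hasDerivAt_line_dotProduct l δ (f := fun _ k => M i k) (f' := 0)
    fun a => hasDerivAt_const _ _
  have h₂ := hasDerivAt_line_dotProduct l δ (f := fun _ k => M k i) (f' := 0)
    fun a => hasDerivAt_const _ _
  simpa [linB] using h₁.fun_add h₂

theorem hasDerivAt_line_trilinear (l : Fin p) (δ : Fin p → ℝ) (q : Fin p → Fin p → Fin p → ℝ) :
    HasDerivAt (fun s : ℝ => (Pi.single l 1 + s • δ) ⬝ᵥ fun a₁ => (Pi.single l 1 + s • δ) ⬝ᵥ
        fun a₂ => (Pi.single l 1 + s • δ) ⬝ᵥ fun a₃ => q a₁ a₂ a₃)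
      ((δ ⬝ᵥ fun k => q k l l) + ((δ ⬝ᵥ fun k => q l k l) + δ ⬝ᵥ fun k => q l l k)) 0 := by
  have h₃ : ∀ a₁ a₂, HasDerivAt (fun s : ℝ => (Pi.single l 1 + s • δ) ⬝ᵥ fun a₃ => q a₁ a₂ a₃)
      (δ ⬝ᵥ fun k => q a₁ a₂ k) 0 := by
    intro a₁ a₂
    simpa using hasDerivAt_line_dotProduct l δ (f := fun _ k => q a₁ a₂ k) (f' := 0)
      fun a => hasDerivAt_const _ _
  have h₂ := fun a₁ => hasDerivAt_line_dotProduct l δ fun a₂ => h₃ a₁ a₂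
  have h₁ := hasDerivAt_line_dotProduct l δ h₂
  simpa using h₁

theorem differentiable_linA (M : Fin p → Fin p → ℝ) : Differentiable ℝ (linA M) := by
  unfold linA dotProduct
  fun_prop

theorem differentiable_quadA (Q : Fin p → Fin p → Fin p → Fin p → ℝ) (c : ℝ) :
    Differentiable ℝ (quadA Q c) := by
  unfold quadA dotProduct
  fun_prop

/-- Meant for the products `linA * linB` and `quadA * quadB` in component `j ≠ l`: the second factor
vanishes at `e_l`, so the derivative of the first never has to be computed. -/
theorem hasDerivAt_mul_of_eq_zero {f g : ℝ → ℝ} {g' x : ℝ} (hf : DifferentiableAt ℝ f x)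
    (hg : HasDerivAt g g' x) (h0 : g x = 0) : HasDerivAt (fun s => f s * g s) (f x * g') x := by
  simpa [h0] using hf.hasDerivAt.fun_mul hg

theorem dotProduct_ite_eq (δ : Fin p → ℝ) (j : Fin p) (c : ℝ) :
    (δ ⬝ᵥ fun k => if k = j then c else 0) = δ j * c := by
  simp [dotProduct]

variable {m : Moments p T₁ T₂} {μ ν : ℕ → Fin p → ℝ}

theorem IsPopulation.momentT_single (hm : IsPopulation m μ ν) (b : ℝ) (l i : Fin p) :
    momentT b m (Pi.single l 1) i = if i = l then
      2 * b * ∑ τ ∈ T₁, μ τ l ^ 2 + 4 * (1 - b) * ∑ τ ∈ T₂, ν τ l * (ν τ l + 1) else 0 := by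
  simp only [momentT, linA_single, linB_single, quadA_single, quadB_single]
  rw [← Finset.sum_coe_sort T₁, ← Finset.sum_coe_sort T₂]
  split_ifs with h
  · subst h
    simp only [hm.lin, hm.quad_self, hm.const, if_true, Finset.mul_sum]
    congr 1 <;> refine Finset.sum_congr rfl fun τ _ => by ring
  · have h₁ : ∀ τ, m.2.1 τ l i l l = 0 := fun τ => by
      rw [hm.quad_left τ i l l h, if_neg (Ne.symm h)]
    have h₂ : ∀ τ, m.2.1 τ l l l i = 0 := fun τ => by
      rw [hm.quad_right τ i l l h, if_neg (Ne.symm h)]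
    simp [hm.lin, h₁, h₂, h, Ne.symm h]

/-- Every moment met here pairs `j` with the summation index and otherwise carries only the index
`l`; independence and centring kill it unless the summation index is `j`. Hence only `δ j` survives.
-/
theorem IsPopulation.hasDerivAt_momentT (hm : IsPopulation m μ ν) (b : ℝ) {j l : Fin p}
    (hjl : j ≠ l) (δ : Fin p → ℝ) :
    HasDerivAt (fun s : ℝ => momentT b m (Pi.single l 1 + s • δ) j)
      (δ j * (2 * b * ∑ τ ∈ T₁, μ τ j * μ τ l
        + 4 * (1 - b) * ∑ τ ∈ T₂, ν τ l * (1 + 2 * μ τ j * μ τ l))) 0 := by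
  have hline : DifferentiableAt ℝ (fun s : ℝ => (Pi.single l 1 + s • δ : Fin p → ℝ)) 0 := by
    fun_prop
  have hlin : ∀ τ : T₁, HasDerivAt (fun s : ℝ => linA (m.1 τ) (Pi.single l 1 + s • δ)
      * linB (m.1 τ) (Pi.single l 1 + s • δ) j) (μ τ l * (δ j * (2 * μ τ j))) 0 := by
    intro τ
    have hB := hasDerivAt_linB_line (m.1 τ) l j δ
    have hA : DifferentiableAt ℝ (fun s : ℝ => linA (m.1 τ) (Pi.single l 1 + s • δ)) 0 :=
      (differentiable_linA (m.1 τ)).differentiableAt.comp _ hline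
    refine (hasDerivAt_mul_of_eq_zero hA hB ?_).congr_deriv ?_
    · simp [linB_single, hm.lin, hjl, hjl.symm]
    · have h₁ : (δ ⬝ᵥ fun k => m.1 τ j k) = δ j * μ τ j := by
        simp only [hm.lin, eq_comm (a := j), dotProduct_ite_eq]
      have h₂ : (δ ⬝ᵥ fun k => m.1 τ k j) = δ j * μ τ j := by
        simp [hm.lin, dotProduct]
      rw [h₁, h₂]
      simp only [zero_smul, add_zero, linA_single, hm.lin, if_true]
      ring
  have hquad : ∀ τ : T₂, HasDerivAt (fun s : ℝ =>
      quadA (m.2.1 τ) (m.2.2.1 τ) (Pi.single l 1 + s • δ)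
        * quadB (m.2.1 τ) (Pi.single l 1 + s • δ) j)
      (ν τ l * (δ j * (2 * (1 + 2 * μ τ j * μ τ l)))) 0 := by
    intro τ
    have hB : HasDerivAt (fun s : ℝ => quadB (m.2.1 τ) (Pi.single l 1 + s • δ) j) _ 0 :=
      (hasDerivAt_line_trilinear l δ fun a₁ a₂ a₃ => m.2.1 τ a₁ j a₂ a₃).add
        (hasDerivAt_line_trilinear l δ fun a₁ a₂ a₃ => m.2.1 τ a₁ a₂ a₃ j)
    have hA : DifferentiableAt ℝ
        (fun s : ℝ => quadA (m.2.1 τ) (m.2.2.1 τ) (Pi.single l 1 + s • δ)) 0 :=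
      (differentiable_quadA (m.2.1 τ) (m.2.2.1 τ)).differentiableAt.comp _ hline
    refine (hasDerivAt_mul_of_eq_zero hA hB ?_).congr_deriv ?_
    · simp [quadB_single, hm.quad_left τ j l l hjl, hm.quad_right τ j l l hjl, hjl.symm]
    · have h₁ : ∀ k, m.2.1 τ k j l l = if k = j then 1 else 0 := fun k => hm.quad_left τ j l k hjl
      have h₂ : ∀ k, m.2.1 τ l j l k = if k = j then μ τ j * μ τ l else 0 :=
        fun k => hm.quad_cross τ j l k hjl
      have h₃ : ∀ k, m.2.1 τ l j k l = if k = j then μ τ j * μ τ l else 0 := fun k => by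
        rw [hm.quad_swap_right, h₂]
      have h₄ : ∀ k, m.2.1 τ l l k j = if k = j then 1 else 0 := fun k => hm.quad_right τ j l k hjl
      have h₅ : ∀ k, m.2.1 τ l k l j = if k = j then μ τ j * μ τ l else 0 :=
        fun k => hm.quad_cross' τ j l k hjl
      have h₆ : ∀ k, m.2.1 τ k l l j = if k = j then μ τ j * μ τ l else 0 := fun k => by
        rw [hm.quad_swap_left, h₅]
      simp only [h₁, h₂, h₃, h₄, h₅, h₆, dotProduct_ite_eq]
      simp only [zero_smul, add_zero, quadA_single, hm.quad_self, hm.const]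
      ring
  have h₁ := (HasDerivAt.fun_sum fun τ (_ : τ ∈ Finset.univ) => hlin τ).const_mul b
  have h₂ := ((HasDerivAt.fun_sum fun τ (_ : τ ∈ Finset.univ) => hquad τ).const_mul 2).const_mul
    (1 - b)
  refine (h₁.add h₂).congr_deriv ?_
  rw [← Finset.sum_coe_sort T₁, ← Finset.sum_coe_sort T₂]
  simp only [Finset.mul_sum, mul_add (δ j)]
  congr 1 <;> refine Finset.sum_congr rfl fun τ _ => by ring

theorem covCoeff_eq (b : ℝ) (T₁ T₂ : Finset ℕ) (μ ν : ℕ → Fin p → ℝ) (j l : Fin p) :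
    covCoeff b T₁ T₂ μ ν j l = (2 * b * ∑ τ ∈ T₁, μ τ j * μ τ l
        + 4 * (1 - b) * ∑ τ ∈ T₂, ν τ l * (1 + 2 * μ τ j * μ τ l))
      - (2 * b * ∑ τ ∈ T₁, μ τ j ^ 2 + 4 * (1 - b) * ∑ τ ∈ T₂, ν τ j * (ν τ j + 1)) := by
  rw [covCoeff, add_sub_add_comm, ← mul_sub, ← mul_sub, ← Finset.sum_sub_distrib,
    ← Finset.sum_sub_distrib]
  congr 2 <;> exact Finset.sum_congr rfl fun τ _ => by ring

theorem denom_eq_neg_covCoeff_sub (b : ℝ) (T₁ T₂ : Finset ℕ) (μ ν : ℕ → Fin p → ℝ)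
    (j l : Fin p) :
    denom b T₁ T₂ μ ν j l = -covCoeff b T₁ T₂ μ ν j l - covCoeff b T₁ T₂ μ ν l j := by
  have h₁ : ∑ τ ∈ T₁, (μ τ j - μ τ l) ^ 2
      = -∑ τ ∈ T₁, μ τ j * (μ τ l - μ τ j) - ∑ τ ∈ T₁, μ τ l * (μ τ j - μ τ l) := by
    rw [← Finset.sum_neg_distrib, ← Finset.sum_sub_distrib]
    exact Finset.sum_congr rfl fun τ _ => by ring
  have h₂ : ∑ τ ∈ T₂, (ν τ j ^ 2 + ν τ l ^ 2 - 2 * (ν τ j + ν τ l) * μ τ j * μ τ l)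
      = -∑ τ ∈ T₂, (ν τ l - ν τ j * (ν τ j + 1) + 2 * ν τ l * μ τ j * μ τ l)
        - ∑ τ ∈ T₂, (ν τ j - ν τ l * (ν τ l + 1) + 2 * ν τ j * μ τ l * μ τ j) := by
    rw [← Finset.sum_neg_distrib, ← Finset.sum_sub_distrib]
    exact Finset.sum_congr rfl fun τ _ => by ring
  rw [denom, covCoeff, covCoeff, h₁, h₂]
  ring

theorem IsPopulation.hasDerivAt_antiEq (hm : IsPopulation m μ ν) (b : ℝ)
    (Δ : Fin p → Fin p → ℝ) (j l : Fin p) :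
    HasDerivAt (fun s : ℝ => antiEq b m (fun i => Pi.single i 1 + s • Δ i) j l)
      (covCoeff b T₁ T₂ μ ν j l * Δ l j - covCoeff b T₁ T₂ μ ν l j * Δ j l) 0 := by
  rcases eq_or_ne j l with rfl | hjl
  · simpa [antiEq] using hasDerivAt_const (0 : ℝ) (0 : ℝ)
  have key : ∀ j l : Fin p, j ≠ l → HasDerivAt (fun s : ℝ =>
      (Pi.single j 1 + s • Δ j) ⬝ᵥ momentT b m (Pi.single l 1 + s • Δ l))
      (Δ j l * (2 * b * ∑ τ ∈ T₁, μ τ l ^ 2 + 4 * (1 - b) * ∑ τ ∈ T₂, ν τ l * (ν τ l + 1))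
        + Δ l j * (2 * b * ∑ τ ∈ T₁, μ τ j * μ τ l
        + 4 * (1 - b) * ∑ τ ∈ T₂, ν τ l * (1 + 2 * μ τ j * μ τ l))) 0 := by
    intro j l hjl
    -- The base vector `e_j` selects the derivative of component `j`; for the other components
    -- existence is enough.
    have hdiff : ∀ a, DifferentiableAt ℝ
        (fun s : ℝ => momentT b m (Pi.single l 1 + s • Δ l) a) 0 := by
      intro a
      simp only [momentT, linA, linB, quadA, quadB, dotProduct]
      fun_prop
    have h := hasDerivAt_line_dotProduct j (Δ j) fun a => (hdiff a).hasDerivAt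
    refine h.congr_deriv ?_
    rw [(hm.hasDerivAt_momentT b hjl (Δ l)).deriv]
    congr 1
    simp only [zero_smul, add_zero]
    rw [← dotProduct_ite_eq]
    congr 1
    funext i
    exact hm.momentT_single b l i
  refine ((key j l hjl).sub (key l j hjl.symm)).congr_deriv ?_
  rw [covCoeff_eq, covCoeff_eq]
  ring

theorem IsPopulation.hasDerivAt_symmEq (hm : IsPopulation m μ ν)
    (Δ : Fin p → Fin p → ℝ) (j l : Fin p) :
    HasDerivAt (fun s : ℝ => symmEq m (fun i => Pi.single i 1 + s • Δ i) j l)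
      (Δ j l + Δ l j) 0 := by
  have h : ∀ s : ℝ, (fun i => m.2.2.2 i ⬝ᵥ (Pi.single l 1 + s • Δ l))
      = fun i => (Pi.single l 1 + s • Δ l : Fin p → ℝ) i := by
    intro s
    funext i
    simp only [dotProduct, hm.cov]
    simp
  simp only [symmEq, h]
  have h₁ := hasDerivAt_line_dotProduct j (Δ j)
    (f := fun s i => (Pi.single l 1 + s • Δ l : Fin p → ℝ) i) (f' := Δ l) fun a =>
      hasDerivAt_const_add_mul _ _
  refine (h₁.sub_const _).congr_deriv ?_
  simp

end

/-! ### Invertible linearization, implicit function and first order expansion. -/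

section

variable {p : ℕ} {T₁ T₂ : Finset ℕ} {m₀ : Moments p T₁ T₂} {μ ν : ℕ → Fin p → ℝ}

/-- The identity matrix, as a family of rows. -/
def idRows (p : ℕ) : Fin p → Fin p → ℝ := fun i => Pi.single i 1

theorem idRows_apply (i j : Fin p) : idRows p i j = (1 : Matrix (Fin p) (Fin p) ℝ) i j := by
  simp [idRows, Matrix.one_apply, Pi.single_apply, eq_comm]

/-- The partial derivative of the estimating equations with respect to the matrix, at the
population moments and the identity matrix. -/
def linearization (b : ℝ) (m₀ : Moments p T₁ T₂) :
    (Fin p → Fin p → ℝ) →L[ℝ] (Fin p → Fin p → ℝ) :=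
  fderiv ℝ (momentEq b) (m₀, idRows p) ∘L .inr ℝ (Moments p T₁ T₂) (Fin p → Fin p → ℝ)

theorem IsPopulation.linearization_apply (hm : IsPopulation m₀ μ ν) (b : ℝ)
    (Δ : Fin p → Fin p → ℝ) (j l : Fin p) :
    linearization b m₀ Δ j l
      = covCoeff b T₁ T₂ μ ν j l * Δ l j - covCoeff b T₁ T₂ μ ν l j * Δ j l + (Δ j l + Δ l j) := by
  -- The Fréchet derivative exists because `momentEq` is polynomial, so its values can be read off
  -- along lines.
  have hf : HasFDerivAt (momentEq b) (fderiv ℝ (momentEq b) (m₀, idRows p)) (m₀, idRows p) :=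
    ((contDiff_momentEq b).differentiable one_ne_zero _).hasFDerivAt
  have hline : HasDerivAt (fun s : ℝ => (m₀, idRows p + s • Δ))
      ((0, Δ) : Moments p T₁ T₂ × (Fin p → Fin p → ℝ)) 0 := by
    refine (hasDerivAt_const (0 : ℝ) m₀).prodMk ?_
    simpa using ((hasDerivAt_id' (0 : ℝ)).smul_const Δ).const_add (idRows p)
  have h := HasFDerivAt.comp_hasDerivAt_of_eq (0 : ℝ) hf hline (by simp)
  exact (hasDerivAt_pi.1 (hasDerivAt_pi.1 h j) l).unique
    ((hm.hasDerivAt_antiEq b Δ j l).add (hm.hasDerivAt_symmEq Δ j l))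

theorem IsPopulation.momentEq_idRows (hm : IsPopulation m₀ μ ν) (b : ℝ) :
    momentEq b (m₀, idRows p) = 0 := by
  funext j l
  rcases eq_or_ne j l with rfl | h
  · simp [momentEq, antiEq, symmEq, idRows, hm.cov]
  · simp [momentEq, antiEq, symmEq, idRows, hm.cov, hm.momentT_single, h, h.symm]

theorem IsPopulation.linearization_injective (hm : IsPopulation m₀ μ ν) {b : ℝ}
    (hsep : ∀ j l, j ≠ l → denom b T₁ T₂ μ ν j l ≠ 0) :
    Function.Injective (linearization b m₀) := by
  rw [injective_iff_map_eq_zero]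
  intro Δ hΔ
  have h : ∀ j l, covCoeff b T₁ T₂ μ ν j l * Δ l j - covCoeff b T₁ T₂ μ ν l j * Δ j l
      + (Δ j l + Δ l j) = 0 := fun j l => by
    rw [← hm.linearization_apply, hΔ]
    rfl
  funext j l
  have hs : Δ l j = -Δ j l := by linarith [h j l, h l j]
  rcases eq_or_ne j l with rfl | hjl
  · change Δ j j = 0
    linarith
  · have h₁ := h j l
    have h₂ : denom b T₁ T₂ μ ν j l * Δ j l = 0 := by
      rw [denom_eq_neg_covCoeff_sub]
      rw [hs] at h₁
      linarith
    exact (mul_eq_zero.1 h₂).resolve_left (hsep j l hjl)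

theorem IsPopulation.linearization_isInvertible (hm : IsPopulation m₀ μ ν) {b : ℝ}
    (hsep : ∀ j l, j ≠ l → denom b T₁ T₂ μ ν j l ≠ 0) :
    (linearization b m₀).IsInvertible :=
  ⟨(LinearEquiv.ofInjectiveEndo (linearization b m₀ : (Fin p → Fin p → ℝ) →ₗ[ℝ] _)
    (hm.linearization_injective hsep)).toContinuousLinearEquiv, by ext; rfl⟩

/-- Local solvability and uniqueness of the estimating equations around the identity. -/
theorem IsPopulation.exists_local_solution (hm : IsPopulation m₀ μ ν) {b : ℝ}
    (hsep : ∀ j l, j ≠ l → denom b T₁ T₂ μ ν j l ≠ 0) :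
    ∃ r > 0, ∃ V : Set (Moments p T₁ T₂), IsOpen V ∧ m₀ ∈ V ∧
      ∃ φ : Moments p T₁ T₂ → Fin p → Fin p → ℝ, ContinuousOn φ V ∧ φ m₀ = idRows p ∧
        ∀ m ∈ V, dist (φ m) (idRows p) ≤ r ∧ momentEq b (m, φ m) = 0 ∧
          ∀ Γ, dist Γ (idRows p) ≤ r → momentEq b (m, Γ) = 0 → Γ = φ m := by
  have hcd : ContDiffAt ℝ 1 (momentEq b) (m₀, idRows p) := (contDiff_momentEq b).contDiffAt
  have hinv : (fderiv ℝ (momentEq b) (m₀, idRows p) ∘L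
      .inr ℝ (Moments p T₁ T₂) (Fin p → Fin p → ℝ)).IsInvertible :=
    hm.linearization_isInvertible hsep
  set φ := hcd.implicitFunction one_ne_zero hinv with hφ
  have hφ₀ : φ m₀ = idRows p := hcd.implicitFunction_apply_self one_ne_zero hinv
  have hφc : ContDiffAt ℝ 1 φ m₀ := hcd.contDiffAt_implicitFunction one_ne_zero hinv
  have hiff := hcd.eventually_apply_eq_iff_implicitFunction one_ne_zero hinv
  rw [← hφ, nhds_prod_eq] at hiff
  obtain ⟨q₁, h₁, q₂, h₂, hq⟩ := Filter.eventually_prod_iff.1 hiff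
  obtain ⟨r, hr, hball⟩ := Metric.nhds_basis_closedBall.mem_iff.1 h₂
  have hnear : ∀ᶠ m in 𝓝 m₀, dist (φ m) (idRows p) ≤ r := by
    have : Tendsto φ (𝓝 m₀) (𝓝 (idRows p)) := hφ₀ ▸ hφc.continuousAt
    exact this.eventually (Metric.closedBall_mem_nhds _ hr)
  -- Continuity of `φ` on a whole open set, not only at `m₀`, is what later makes the estimator
  -- measurable.
  obtain ⟨V, hV, hVo, hmV⟩ := eventually_nhds_iff.1
    ((h₁.and hnear).and ((hφc.eventually (by simp)).mono fun m h => h.continuousAt))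
  refine ⟨r, hr, V, hVo, hmV, φ, fun m h => (hV m h).2.continuousWithinAt, hφ₀, ?_⟩
  intro m h
  obtain ⟨⟨hm₁, hm₂⟩, -⟩ := hV m h
  refine ⟨hm₂, ?_, fun Γ hΓ h0 => ?_⟩
  · rw [(hq hm₁ (hball hm₂)).2 rfl]
    exact hm.momentEq_idRows b
  · refine ((hq hm₁ (hball hΓ)).1 ?_).symm
    rw [h0]
    exact (hm.momentEq_idRows b).symm

/-- First order expansion of the solutions of the estimating equations around the identity. -/
theorem IsPopulation.isLittleO_of_solution (hm : IsPopulation m₀ μ ν) {b : ℝ}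
    (hsep : ∀ j l, j ≠ l → denom b T₁ T₂ μ ν j l ≠ 0) {Z : Type*} {𝓛 : Filter Z}
    {m : Z → Moments p T₁ T₂} {Γ : Z → Fin p → Fin p → ℝ} (hmlim : Tendsto m 𝓛 (𝓝 m₀))
    (hΓ : Tendsto Γ 𝓛 (𝓝 (idRows p))) (hsol : ∀ᶠ z in 𝓛, momentEq b (m z, Γ z) = 0) :
    (fun z => momentEq b (m z, idRows p) + linearization b m₀ (Γ z - idRows p))
      =o[𝓛] fun z => momentEq b (m z, idRows p) := by
  set R := fun z => momentEq b (m z, idRows p) + linearization b m₀ (Γ z - idRows p) with hR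
  have hstrict := (((contDiff_momentEq b).contDiffAt (x := (m₀, idRows p))).hasStrictFDerivAt
    one_ne_zero).isLittleO
  have hpair :=
    (hmlim.prodMk_nhds hΓ).prodMk_nhds (hmlim.prodMk_nhds (tendsto_const_nhds (x := idRows p)))
  -- Both points share the coordinate `m z`, so their difference is `(0, Γ z - I)`, and only the
  -- partial derivative in `Γ` enters.
  have h₁ : R =o[𝓛] fun z => Γ z - idRows p := by
    have h := (hstrict.comp_tendsto hpair).neg_left
    refine (h.congr' ?_ (EventuallyEq.refl _ _)).trans_isBigO
      (Asymptotics.IsBigO.of_bound 1 (.of_forall fun z => ?_))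
    · filter_upwards [hsol] with z hz
      simp only [Function.comp_apply, hz, hR, linearization, ContinuousLinearMap.comp_apply,
        ContinuousLinearMap.inr_apply, Prod.mk_sub_mk, sub_self]
      abel
    · simp [Prod.norm_def]
  obtain ⟨e, he⟩ := hm.linearization_isInvertible hsep
  have h₂ : (fun z => Γ z - idRows p) =O[𝓛] fun z => R z - momentEq b (m z, idRows p) := by
    have h := (e.symm : (Fin p → Fin p → ℝ) →L[ℝ] (Fin p → Fin p → ℝ)).isBigO_comp
      (fun z => linearization b m₀ (Γ z - idRows p)) 𝓛
    refine h.congr (fun z => ?_) (fun z => ?_)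
    · rw [← he]
      simp
    · simp [hR]
  -- Now `R = o(R - F)` for `F = momentEq b (m z, I)`. Absorbing `R` gives `R - F = O(F)`, hence `R
  -- = o(F)`.
  have h₃ := h₁.trans_isBigO h₂
  refine h₃.trans_isBigO (h₃.right_isBigO_sub.trans ?_)
  exact Asymptotics.IsBigO.of_bound 1 (.of_forall fun z => by simp)

end

/-! ### Population moments and their estimation -/

section

variable {Ω : Type*} [MeasurableSpace Ω] {P : Measure Ω} {p : ℕ} {x : ℤ → Ω → Fin p → ℝ}

/-- The limits of the sample moments. -/
def popMoments (P : Measure Ω) (x : ℤ → Ω → Fin p → ℝ) (T₁ T₂ : Finset ℕ) : Moments p T₁ T₂ :=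
  (fun τ i k => ∫ ω, x 0 ω i * x ((τ : ℕ) : ℤ) ω k ∂P,
    fun τ i k u v => ∫ ω, x 0 ω i * x 0 ω k *
      (x ((τ : ℕ) : ℤ) ω u * x ((τ : ℕ) : ℤ) ω v) ∂P,
    fun _ => 1, fun i k => if i = k then 1 else 0)

/-- The case `i = l` is allowed, so one statement serves moments involving two or three distinct
components. -/
theorem integral_mul_of_iIndepFun (hmeas : ∀ t, Measurable (x t))
    (hindep : iIndepFun (fun (j : Fin p) (ω : Ω) (t : ℤ) => x t ω j) P) {i l j : Fin p}
    (hij : i ≠ j) (hlj : l ≠ j) {f : (ℤ → ℝ) × (ℤ → ℝ) → ℝ} {g : (ℤ → ℝ) → ℝ}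
    (hf : Measurable f) (hg : Measurable g) :
    ∫ ω, f (fun t => x t ω i, fun t => x t ω l) * g (fun t => x t ω j) ∂P
      = (∫ ω, f (fun t => x t ω i, fun t => x t ω l) ∂P) * ∫ ω, g (fun t => x t ω j) ∂P := by
  have hX : ∀ k : Fin p, Measurable fun (ω : Ω) (t : ℤ) => x t ω k := fun k =>
    measurable_pi_lambda _ fun t => (measurable_pi_apply k).comp (hmeas t)
  have h := (hindep.indepFun_prodMk hX i l j hij hlj).comp hf hg
  exact h.integral_fun_mul_eq_mul_integral
    (hf.comp ((hX i).prodMk (hX l))).aestronglyMeasurable (hg.comp (hX j)).aestronglyMeasurable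

theorem integral_mul_eq_zero_of_ne (hmeas : ∀ t, Measurable (x t))
    (hindep : iIndepFun (fun (j : Fin p) (ω : Ω) (t : ℤ) => x t ω j) P)
    (hmean : ∀ t j, ∫ ω, x t ω j ∂P = 0) {i k : Fin p} (hik : i ≠ k) (s t : ℤ) :
    ∫ ω, x s ω i * x t ω k ∂P = 0 := by
  have h := integral_mul_of_iIndepFun hmeas hindep hik hik (f := fun y => y.1 s)
    (g := fun y => y t) (by fun_prop) (by fun_prop)
  rw [h, hmean t k, mul_zero]

/-- If `k ≠ j`, possibly with `k = l`, component `j` occurs in a single factor, which splits off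
with mean zero. Free time indices cover all the mixed fourth moments of `IsPopulation`. -/
theorem integral_mul_mul_mul_of_ne (hmeas : ∀ t, Measurable (x t))
    (hindep : iIndepFun (fun (j : Fin p) (ω : Ω) (t : ℤ) => x t ω j) P)
    (hmean : ∀ t j, ∫ ω, x t ω j ∂P = 0) {j l : Fin p} (hjl : j ≠ l) (k : Fin p)
    (s₁ s₂ s₃ s₄ : ℤ) :
    ∫ ω, x s₁ ω l * x s₂ ω l * (x s₃ ω k * x s₄ ω j) ∂P = if k = j then
      (∫ ω, x s₁ ω l * x s₂ ω l ∂P) * ∫ ω, x s₃ ω j * x s₄ ω j ∂P else 0 := by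
  split_ifs with h
  · subst h
    exact integral_mul_of_iIndepFun hmeas hindep hjl.symm hjl.symm
      (f := fun y => y.1 s₁ * y.1 s₂) (g := fun y => y s₃ * y s₄) (by fun_prop) (by fun_prop)
  · have h' := integral_mul_of_iIndepFun hmeas hindep hjl.symm h
      (f := fun y => y.1 s₁ * y.1 s₂ * y.2 s₃) (g := fun y => y s₄) (by fun_prop) (by fun_prop)
    rw [hmean s₄ j, mul_zero] at h'
    rw [← h']
    exact integral_congr_ae (.of_forall fun ω => (mul_assoc _ _ _).symm)

theorem isPopulation_popMoments (hmeas : ∀ t, Measurable (x t))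
    (hmean : ∀ t j, ∫ ω, x t ω j ∂P = 0)
    (hcov : ∀ t j l, ∫ ω, x t ω j * x t ω l ∂P = if j = l then 1 else 0)
    (hindep : iIndepFun (fun (j : Fin p) (ω : Ω) (t : ℤ) => x t ω j) P) (T₁ T₂ : Finset ℕ) :
    IsPopulation (popMoments P x T₁ T₂) (linCorr P x) (quadCorr P x) where
  lin τ i k := by
    split_ifs with h
    · subst h
      rfl
    · exact integral_mul_eq_zero_of_ne hmeas hindep hmean h _ _
  quad_self τ l := by
    rw [quadCorr, sub_add_cancel]
    exact integral_congr_ae (.of_forall fun ω => by ring)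
  quad_left τ j l k hjl := by
    have h := integral_mul_mul_mul_of_ne hmeas hindep hmean hjl k (τ : ℕ) (τ : ℕ) 0 0
    rw [hcov, hcov, if_pos rfl, if_pos rfl, mul_one] at h
    rw [← h]
    exact integral_congr_ae (.of_forall fun ω => by ring)
  quad_right τ j l k hjl := by
    have h := integral_mul_mul_mul_of_ne hmeas hindep hmean hjl k 0 0 (τ : ℕ) (τ : ℕ)
    rwa [hcov, hcov, if_pos rfl, if_pos rfl, mul_one] at h
  quad_cross τ j l k hjl := by
    have h := integral_mul_mul_mul_of_ne hmeas hindep hmean hjl k 0 (τ : ℕ) (τ : ℕ) 0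
    have h' : ∫ ω, x ((τ : ℕ) : ℤ) ω j * x 0 ω j ∂P = linCorr P x τ j :=
      integral_congr_ae (.of_forall fun ω => mul_comm _ _)
    rw [h', mul_comm] at h
    exact (integral_congr_ae (.of_forall fun ω => by ring)).trans h
  quad_cross' τ j l k hjl := by
    have h := integral_mul_mul_mul_of_ne hmeas hindep hmean hjl k 0 (τ : ℕ) 0 (τ : ℕ)
    rw [mul_comm] at h
    exact (integral_congr_ae (.of_forall fun ω => by ring)).trans h
  quad_swap_left τ i k u v := integral_congr_ae (.of_forall fun ω => by ring)
  quad_swap_right τ i k u v := integral_congr_ae (.of_forall fun ω => by ring)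
  const τ := rfl
  cov i k := rfl

theorem memLp_two_mul (hmom : ∀ t j, MemLp (fun ω => x t ω j) 4 P) (s t : ℤ) (i k : Fin p) :
    MemLp (fun ω => x s ω i * x t ω k) 2 P := by
  have : ENNReal.HolderTriple 4 4 2 := ⟨by
    rw [← two_mul, show (4 : ℝ≥0∞) = 2 * 2 by norm_num,
      ENNReal.mul_inv (by simp) (by simp), ← mul_assoc,
      ENNReal.mul_inv_cancel (by simp) (by simp), one_mul]⟩
  exact (hmom t k).mul' (hmom s i)

theorem sampleCov_eq {n : ℕ} (hn : n ≠ 0) (y : ℤ → Fin p → ℝ) (i k : Fin p) :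
    sampleCov n y i k = lagMean n 0 (fun t => y t i * y t k) -
      lagMean n 0 (fun t => y t i) * lagMean n 0 (fun t => y t k) := by
  have hn' : (n : ℝ) ≠ 0 := by exact_mod_cast hn
  simp only [sampleCov, Matrix.of_apply, sampleMean]
  set a := lagMean n 0 (fun t => y t i) with ha
  set c := lagMean n 0 (fun t => y t k) with hc
  have h₁ : ∑ t ∈ Finset.Icc 1 (n - 0), y t i = n * a := by
    rw [ha, lagMean]; field_simp
  have h₂ : ∑ t ∈ Finset.Icc 1 (n - 0), y t k = n * c := by
    rw [hc, lagMean]; field_simp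
  simp only [lagMean, sub_mul, mul_sub, Finset.sum_sub_distrib, ← Finset.mul_sum,
    ← Finset.sum_mul, h₁, h₂, Finset.sum_const, Nat.card_Icc, nsmul_eq_mul]
  simp only [Nat.sub_zero, Nat.add_sub_cancel]
  field_simp
  ring

theorem tendsto_sampleMoments [IsProbabilityMeasure P] (hmeas : ∀ t, Measurable (x t))
    (herg : Ergodic (fun (y : ℤ → Fin p → ℝ) (t : ℤ) => y (t + 1))
      (P.map (fun ω (t : ℤ) => x t ω)))
    (hmom : ∀ t j, MemLp (fun ω => x t ω j) 4 P)
    (hmean : ∀ t j, ∫ ω, x t ω j ∂P = 0)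
    (hcov : ∀ t j l, ∫ ω, x t ω j * x t ω l ∂P = if j = l then 1 else 0) (T₁ T₂ : Finset ℕ) :
    Tendsto (fun z : ℕ × Ω => sampleMoments T₁ T₂ z.1 fun t => x t z.2) (probFilter P)
      (𝓝 (popMoments P x T₁ T₂)) := by
  have hlin : ∀ (τ : ℕ) (i k : Fin p), Tendsto (fun z : ℕ × Ω =>
      lagMean z.1 τ fun t => x t z.2 i * x (t + τ) z.2 k) (probFilter P)
      (𝓝 (∫ ω, x 0 ω i * x τ ω k ∂P)) := by
    intro τ i k
    have h := tendsto_lagMean hmeas herg τ (g := fun y => y 0 i * y τ k) (by fun_prop)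
      ((memLp_two_mul hmom 0 τ i k).integrable (by norm_num))
    simpa only [zero_add, add_comm (τ : ℤ)] using h
  have hone : ∀ i : Fin p, Tendsto (fun z : ℕ × Ω =>
      lagMean z.1 0 fun t => x t z.2 i) (probFilter P) (𝓝 0) := by
    intro i
    have h := tendsto_lagMean hmeas herg 0 (g := fun y => y 0 i) (by fun_prop)
      ((hmom 0 i).integrable (by norm_num))
    rw [hmean 0 i] at h
    simpa only [zero_add] using h
  refine Tendsto.prodMk_nhds ?_ (Tendsto.prodMk_nhds ?_ (Tendsto.prodMk_nhds ?_ ?_))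
  · exact tendsto_pi_nhds.2 fun τ => tendsto_pi_nhds.2 fun i => tendsto_pi_nhds.2 fun k =>
      hlin τ i k
  · refine tendsto_pi_nhds.2 fun τ => tendsto_pi_nhds.2 fun i => tendsto_pi_nhds.2 fun k =>
      tendsto_pi_nhds.2 fun u => tendsto_pi_nhds.2 fun v => ?_
    have h := tendsto_lagMean hmeas herg τ
      (g := fun y => y 0 i * y 0 k * (y (τ : ℕ) u * y (τ : ℕ) v)) (by fun_prop)
      ((memLp_two_mul hmom 0 0 i k).integrable_mul
        (memLp_two_mul hmom (τ : ℕ) (τ : ℕ) u v))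
    simpa only [zero_add, add_comm ((τ : ℕ) : ℤ)] using h
  · refine tendsto_pi_nhds.2 fun τ => ?_
    have h := tendsto_lagMean hmeas herg τ (g := fun _ => 1) (by fun_prop) (integrable_const _)
    simpa using h
  · refine tendsto_pi_nhds.2 fun i => tendsto_pi_nhds.2 fun k => ?_
    have h := (hlin 0 i k).sub ((hone i).mul (hone k))
    simp only [Nat.cast_zero, add_zero, hcov, mul_zero, sub_zero] at h
    refine h.congr' ?_
    filter_upwards [(tendsto_fst_probFilter (P := P)).eventually_ne_atTop 0] with z hz
    exact (sampleCov_eq hz (fun t => x t z.2) i k).symm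

end

/-! ### Existence and expansion of the estimator -/

section

variable {p : ℕ}

/-- Observations `x_1, …, x_n` extended by zero to a series. -/
def extendSeries (n : ℕ) (d : Fin n → Fin p → ℝ) (t : ℤ) : Fin p → ℝ :=
  if h : 1 ≤ t ∧ t ≤ n then d ⟨(t - 1).toNat, by omega⟩ else 0

theorem measurable_extendSeries (n : ℕ) (t : ℤ) (i : Fin p) :
    Measurable fun d : Fin n → Fin p → ℝ => extendSeries n d t i := by
  unfold extendSeries
  split_ifs with h
  · fun_prop
  · exact measurable_const

/-- The sample moments never look outside times `1, …, n`, so the estimator built from them is a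
function of the observations alone. -/
theorem sampleMoments_extendSeries (T₁ T₂ : Finset ℕ) (n : ℕ) (y : ℤ → Fin p → ℝ) :
    sampleMoments T₁ T₂ n (extendSeries n fun k => y (((k : ℕ) : ℤ) + 1))
      = sampleMoments T₁ T₂ n y := by
  refine sampleMoments_congr fun t h₁ h₂ => ?_
  rw [extendSeries, dif_pos ⟨h₁, h₂⟩]
  congr 1
  change (((t - 1).toNat : ℕ) : ℤ) + 1 = t
  omega

theorem norm_apply_apply_le (A : Fin p → Fin p → ℝ) (j l : Fin p) : ‖A j l‖ ≤ ‖A‖ :=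
  (norm_le_pi_norm (A j) l).trans (norm_le_pi_norm A j)

set_option synthInstance.maxSize 1000 in
instance opensMeasurableSpace_moments (T₁ T₂ : Finset ℕ) :
    OpensMeasurableSpace (Moments p T₁ T₂) :=
  inferInstance

theorem dist_idRows_le_iff {r : ℝ} (hr : 0 ≤ r) (Γ : Matrix (Fin p) (Fin p) ℝ) :
    dist (fun i j => Γ i j) (idRows p) ≤ r ↔
      ∀ i j, |Γ i j - (1 : Matrix (Fin p) (Fin p) ℝ) i j| ≤ r := by
  simp only [dist_pi_le_iff hr, Real.dist_eq, idRows_apply]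

theorem antiEq_sampleMoments_idRows (b : ℝ) (T₁ T₂ : Finset ℕ) (n : ℕ) (y : ℤ → Fin p → ℝ)
    (j l : Fin p) : antiEq b (sampleMoments T₁ T₂ n y) (idRows p) j l
      = Tvec b T₁ T₂ n y l j - Tvec b T₁ T₂ n y j l := by
  simp [antiEq, idRows, Tvec_eq_momentT]

theorem symmEq_sampleMoments_idRows (T₁ T₂ : Finset ℕ) (n : ℕ) (y : ℤ → Fin p → ℝ)
    (j l : Fin p) : symmEq (sampleMoments T₁ T₂ n y) (idRows p) j l
      = sampleCov n y j l - if j = l then 1 else 0 := by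
  simp [symmEq, idRows, sampleMoments]

variable {Ω : Type*} [MeasurableSpace Ω] {P : Measure Ω}

theorem isEstimator_iff {b r : ℝ} (hr : 0 ≤ r) {T₁ T₂ : Finset ℕ} {x : ℤ → Ω → Fin p → ℝ}
    {Γ : ℕ → Ω → Matrix (Fin p) (Fin p) ℝ} :
    IsEstimator P b T₁ T₂ x r Γ ↔ ∀ᶠ z in probFilter P,
      momentEq b (sampleMoments T₁ T₂ z.1 fun t => x t z.2, fun i j => Γ z.1 z.2 i j) = 0 ∧
        dist (fun i j => Γ z.1 z.2 i j) (idRows p) ≤ r := by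
  rw [eventually_probFilter]
  simp only [dist_idRows_le_iff hr, ← solvesEstEq_iff]
  rfl

/-- On the diagonal the antisymmetric part vanishes, so no bound on `e_jᵀT_j` is needed. The sup
norm is controlled by the sum of the `p²` entries. -/
theorem bddInProb_norm_momentEq {b : ℝ} {T₁ T₂ : Finset ℕ} {x : ℤ → Ω → Fin p → ℝ}
    (hS : ∀ j l, BddInProb P (fun (n : ℕ) ω =>
      √(n : ℝ) * (sampleCov n (fun t => x t ω) j l - if j = l then 1 else 0)))
    (hT : ∀ j l, j ≠ l → BddInProb P (fun (n : ℕ) ω =>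
      √(n : ℝ) * Tvec b T₁ T₂ n (fun t => x t ω) j l)) :
    BddInProb P fun n ω =>
      √(n : ℝ) * ‖momentEq b (sampleMoments T₁ T₂ n fun t => x t ω, idRows p)‖ := by
  have hentry : ∀ j l, BddInProb P fun (n : ℕ) ω =>
      |√(n : ℝ) * momentEq b (sampleMoments T₁ T₂ n fun t => x t ω, idRows p) j l| := by
    intro j l
    have h : BddInProb P fun (n : ℕ) ω =>
        √(n : ℝ) * momentEq b (sampleMoments T₁ T₂ n fun t => x t ω, idRows p) j l := by
      simp only [momentEq, antiEq_sampleMoments_idRows, symmEq_sampleMoments_idRows]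
      rcases eq_or_ne j l with rfl | hjl
      · simpa using hS j j
      · have hneg : BddInProb P (fun (n : ℕ) ω =>
            -(√(n : ℝ) * Tvec b T₁ T₂ n (fun t => x t ω) j l)) :=
          (hT j l hjl).mono fun n ω => by rw [abs_neg]
        have h := ((hT l j hjl.symm).add hneg).add (hS j l)
        refine h.mono fun n ω => le_of_eq ?_
        congr 1
        ring
    exact h.mono fun n ω => by rw [abs_abs]
  have hsum := BddInProb.sum Finset.univ fun j (_ : j ∈ Finset.univ) =>
    BddInProb.sum Finset.univ fun l (_ : l ∈ Finset.univ) => hentry j l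
  refine hsum.mono fun n ω => ?_
  have hnn : ∀ j, 0 ≤ ∑ l, |√(n : ℝ) *
      momentEq b (sampleMoments T₁ T₂ n fun t => x t ω, idRows p) j l| := fun j =>
    Finset.sum_nonneg fun l _ => abs_nonneg _
  rw [abs_of_nonneg (by positivity), abs_of_nonneg (Finset.sum_nonneg fun j _ => hnn j)]
  have hnorm : √(n : ℝ) * ‖momentEq b (sampleMoments T₁ T₂ n fun t => x t ω, idRows p)‖
      = ‖√(n : ℝ) • momentEq b (sampleMoments T₁ T₂ n fun t => x t ω, idRows p)‖ := by
    rw [norm_smul, Real.norm_of_nonneg (Real.sqrt_nonneg _)]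
  rw [hnorm, pi_norm_le_iff_of_nonneg (Finset.sum_nonneg fun j _ => hnn j)]
  intro j
  refine ((pi_norm_le_iff_of_nonneg (hnn j)).2 fun l => ?_).trans
    (Finset.single_le_sum (fun j _ => hnn j) (Finset.mem_univ j))
  exact Finset.single_le_sum (f := fun l => |√(n : ℝ) *
    momentEq b (sampleMoments T₁ T₂ n fun t => x t ω, idRows p) j l|)
    (fun l _ => abs_nonneg _) (Finset.mem_univ l)

end

end GSOBI

end

/-! ### Existence, consistency and expansion of the localized estimator. -/

theorem theorem1 {Ω : Type*} [MeasurableSpace Ω] (P : Measure Ω) [IsProbabilityMeasure P]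
    {p : ℕ} (b : ℝ) (hb0 : 0 ≤ b) (hb1 : b ≤ 1) (T₁ T₂ : Finset ℕ)
    (x : ℤ → Ω → Fin p → ℝ)
    -- strictly stationary ergodic process with finite fourth moments
    (hmeas : ∀ t, Measurable (x t))
    (herg : Ergodic (fun (y : ℤ → Fin p → ℝ) (t : ℤ) => y (t + 1))
      (P.map (fun ω (t : ℤ) => x t ω)))
    (hmom : ∀ t j, MemLp (fun ω => x t ω j) 4 P)
    -- (A1): centred with identity covariance matrix
    (hmean : ∀ t j, ∫ ω, x t ω j ∂P = 0)
    (hcov : ∀ t j l, ∫ ω, x t ω j * x t ω l ∂P = if j = l then 1 else 0)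
    -- (A2): the component series are mutually independent
    (hindep : iIndepFun (fun (j : Fin p) (ω : Ω) (t : ℤ) => x t ω j) P)
    -- (A3): every pair of components is separated by the weighted autocorrelations
    (hsep : ∀ j l, j ≠ l →
      GSOBI.denom b T₁ T₂ (GSOBI.linCorr P x) (GSOBI.quadCorr P x) j l ≠ 0) :
    ∃ r : ℝ, 0 < r ∧
      -- existence, as a measurable function of the observations `x_1, …, x_n`
      (∃ G : (n : ℕ) → (Fin n → Fin p → ℝ) → Matrix (Fin p) (Fin p) ℝ,
        (∀ n i j, Measurable (fun d => G n d i j)) ∧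
        GSOBI.IsEstimator P b T₁ T₂ x r
          (fun n ω => G n (fun k => x (((k : ℕ) : ℤ) + 1) ω))) ∧
      ∀ Γ : ℕ → Ω → Matrix (Fin p) (Fin p) ℝ, GSOBI.IsEstimator P b T₁ T₂ x r Γ →
        -- consistency
        (∀ j l, TendstoInMeasure P (fun n ω => Γ n ω j l) atTop
          (fun _ => (1 : Matrix (Fin p) (Fin p) ℝ) j l)) ∧
        -- expansions, when the statistics occurring in them are root-n consistent
        ((∀ j l, GSOBI.BddInProb P (fun (n : ℕ) ω =>
            √(n : ℝ) * (GSOBI.sampleCov n (fun t => x t ω) j l - if j = l then 1 else 0))) →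
          (∀ j l, j ≠ l → GSOBI.BddInProb P (fun (n : ℕ) ω =>
            √(n : ℝ) * GSOBI.Tvec b T₁ T₂ n (fun t => x t ω) j l)) →
          (∀ j, TendstoInMeasure P (fun (n : ℕ) ω =>
            √(n : ℝ) * (Γ n ω j j - 1)
              - (-(1 / 2) * (√(n : ℝ) * (GSOBI.sampleCov n (fun t => x t ω) j j - 1))))
            atTop (fun _ => (0 : ℝ))) ∧
          (∀ j l, j ≠ l → TendstoInMeasure P (fun (n : ℕ) ω =>
            √(n : ℝ) * Γ n ω j l
              - (√(n : ℝ) * GSOBI.Tvec b T₁ T₂ n (fun t => x t ω) j l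
                  - √(n : ℝ) * GSOBI.Tvec b T₁ T₂ n (fun t => x t ω) l j
                  + GSOBI.covCoeff b T₁ T₂ (GSOBI.linCorr P x) (GSOBI.quadCorr P x) j l
                    * (√(n : ℝ) * GSOBI.sampleCov n (fun t => x t ω) j l))
                * (GSOBI.denom b T₁ T₂ (GSOBI.linCorr P x) (GSOBI.quadCorr P x) j l)⁻¹)
            atTop (fun _ => (0 : ℝ)))) := by
  have hpop := GSOBI.isPopulation_popMoments hmeas hmean hcov hindep T₁ T₂
  have hlim := GSOBI.tendsto_sampleMoments hmeas herg hmom hmean hcov T₁ T₂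
  obtain ⟨r, hr, V, hVo, hmV, φ, hφc, hφ₀, hφ⟩ := hpop.exists_local_solution hsep
  have hV : ∀ᶠ z in GSOBI.probFilter P,
      GSOBI.sampleMoments T₁ T₂ z.1 (fun t => x t z.2) ∈ V := hlim.eventually (hVo.mem_nhds hmV)
  refine ⟨r, hr, ?_, fun Γ hΓ => ?_⟩
  · classical
    -- Outside `V` any measurable default would do, since the sample moments lie in `V` with
    -- probability tending to one.
    refine ⟨fun n d => Matrix.of (V.piecewise φ (fun _ => GSOBI.idRows p)
      (GSOBI.sampleMoments T₁ T₂ n (GSOBI.extendSeries n d))), fun n i j => ?_, ?_⟩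
    · have h₁ := hφc.measurable_piecewise (g := fun _ => GSOBI.idRows p)
        continuousOn_const hVo.measurableSet
      have h₂ := h₁.comp (GSOBI.measurable_sampleMoments (T₁ := T₁) (T₂ := T₂) n
        (GSOBI.measurable_extendSeries (p := p) n))
      exact (measurable_pi_apply j).comp ((measurable_pi_apply i).comp h₂)
    · rw [GSOBI.isEstimator_iff hr.le]
      filter_upwards [hV] with z hz
      have h := GSOBI.sampleMoments_extendSeries T₁ T₂ z.1 fun t => x t z.2
      simp only [h, Set.piecewise_eq_of_mem _ _ _ hz, Matrix.of_apply]
      exact ⟨(hφ _ hz).2.1, (hφ _ hz).1⟩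
  rw [GSOBI.isEstimator_iff hr.le] at hΓ
  have hΓlim : Tendsto (fun z : ℕ × Ω => fun i j => Γ z.1 z.2 i j) (GSOBI.probFilter P)
      (𝓝 (GSOBI.idRows p)) := by
    have h : Tendsto (fun z : ℕ × Ω => φ (GSOBI.sampleMoments T₁ T₂ z.1 fun t => x t z.2))
        (GSOBI.probFilter P) (𝓝 (GSOBI.idRows p)) :=
      hφ₀ ▸ ((hφc.continuousAt (hVo.mem_nhds hmV)).tendsto.comp hlim)
    refine h.congr' ?_
    filter_upwards [hV, hΓ] with z hz hz'
    exact ((hφ _ hz).2.2 _ hz'.2 hz'.1).symm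
  refine ⟨fun j l => ?_, fun hS hT => ?_⟩
  · rw [← GSOBI.tendsto_probFilter_iff_tendstoInMeasure, ← GSOBI.idRows_apply]
    exact tendsto_pi_nhds.1 (tendsto_pi_nhds.1 hΓlim j) l
  have hR := GSOBI.tendsto_zero_of_isLittleO_bddInProb (fun n => Real.sqrt_nonneg (n : ℝ))
    (hpop.isLittleO_of_solution hsep hlim hΓlim (hΓ.mono fun z hz => hz.1))
    (GSOBI.bddInProb_norm_momentEq hS hT)
  set c := GSOBI.covCoeff b T₁ T₂ (GSOBI.linCorr P x) (GSOBI.quadCorr P x) with hc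
  have hentry : ∀ j l, Tendsto (fun z : ℕ × Ω => √(z.1 : ℝ) *
      ((GSOBI.Tvec b T₁ T₂ z.1 (fun t => x t z.2) l j
          - GSOBI.Tvec b T₁ T₂ z.1 (fun t => x t z.2) j l
        + (GSOBI.sampleCov z.1 (fun t => x t z.2) j l - if j = l then 1 else 0))
        + (c j l * (Γ z.1 z.2 l j - GSOBI.idRows p l j)
          - c l j * (Γ z.1 z.2 j l - GSOBI.idRows p j l)
          + ((Γ z.1 z.2 j l - GSOBI.idRows p j l) + (Γ z.1 z.2 l j - GSOBI.idRows p l j)))))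
      (GSOBI.probFilter P) (𝓝 0) := by
    intro j l
    refine squeeze_zero_norm (fun z => ?_) hR
    rw [norm_mul, Real.norm_of_nonneg (Real.sqrt_nonneg _)]
    refine mul_le_mul_of_nonneg_left ?_ (Real.sqrt_nonneg _)
    refine le_trans (le_of_eq ?_) (GSOBI.norm_apply_apply_le _ j l)
    rw [Pi.add_apply, Pi.add_apply, hpop.linearization_apply, GSOBI.momentEq,
      GSOBI.antiEq_sampleMoments_idRows, GSOBI.symmEq_sampleMoments_idRows]
    rfl
  refine ⟨fun j => ?_, fun j l hjl => ?_⟩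
  · rw [← GSOBI.tendsto_probFilter_iff_tendstoInMeasure]
    have h := (hentry j j).const_mul (1 / 2)
    rw [mul_zero] at h
    refine h.congr fun z => ?_
    simp only [GSOBI.idRows_apply, Matrix.one_apply_eq, if_true]
    ring
  · rw [← GSOBI.tendsto_probFilter_iff_tendstoInMeasure]
    have hD := hsep j l hjl
    have hDc := GSOBI.denom_eq_neg_covCoeff_sub b T₁ T₂ (GSOBI.linCorr P x)
      (GSOBI.quadCorr P x) j l
    rw [← hc] at hDc
    set D := GSOBI.denom b T₁ T₂ (GSOBI.linCorr P x) (GSOBI.quadCorr P x) j l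
    -- With `A` and `B` the antisymmetric and symmetric parts, the entries `jl` and `lj` are `B + A`
    -- and `B - A`. These weights produce `A - c_{jl} B`, in which `Δ_{lj}` cancels and `Δ_{jl}` has
    -- coefficient `-c_{jl} - c_{lj} = D`.
    have h := (((hentry j l).const_mul ((1 - c j l) / 2)).sub
      ((hentry l j).const_mul ((1 + c j l) / 2))).mul_const D⁻¹
    simp only [mul_zero, sub_zero, zero_mul] at h
    refine h.congr fun z => ?_
    rw [GSOBI.sampleCov_symm z.1 _ l j]
    simp only [GSOBI.idRows_apply, Matrix.one_apply_ne hjl, Matrix.one_apply_ne hjl.symm,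
      if_neg hjl, if_neg hjl.symm, sub_zero]
    rw [eq_sub_iff_add_eq, ← add_mul, ← div_eq_mul_inv, div_eq_iff hD, hDc]
    ring
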